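/- **Conventions.** Let $p$ be a prime. For a finite Abelian group $G$ and $f:G\to\{-1,+1\}$, the Fourier coefficient of $f$ at a character $\chi$ of $G$ is $\widehat f(\chi)=\frac1{|G|}\sum_{x\in G}f(x)\overline{\chi(x)}$, and the sparsity $s_f$ is the number of characters with $\widehat f(\chi)\neq 0$. A function is $s$-sparse if $s_f\le s$. A function $f:\mathbb Z_p^n\to\{-1,+1\}$ is $\varepsilon$-far from a class $\mathcal P$ of such functions if $\mathbb E_x|f(x)-g(x)|^2\ge\varepsilon$ for every $g\in\mathcal P$. The degree $\deg_p(f)$ is the largest dimension of an affine subspace $V\subseteq\mathbb Z_p^n$ (a nonempty solution set of a system of linear equations over $\mathbb Z_p$) such that $f|_V$ has full sparsity, $s_{f|_V}=p^{\dim V}$. A (randomized, adaptive) $q$-query algorithm is a probability distribution on decision trees of depth at most $q$ whose inner nodes query values $f(x)$ and whose leaves accept or reject. It is an $\varepsilon$-tester for $s$-sparsity on $\mathbb Z_p^n$ if it accepts every $s$-sparse $f:\mathbb Z_p^n\to\{-1,+1\}$ with probability at least $2/3$ and rejects every $f:\mathbb Z_p^n\to\{-1,+1\}$ that is $\varepsilon$-far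 from the class of $s$-sparse functions $\mathbb Z_p^n\to\{-1,+1\}$ with probability at least $2/3$. For $0\le d\le n$ let $\mathcal D_{\mathrm{Yes}}^{n,d}$ be the distribution of a random function obtained by choosing a uniformly random $d$-dimensional subspace $H$ of $\mathbb Z_p^n$ and giving $f$ an independent uniformly random constant value in $\{-1,+1\}$ on each coset of $H$. Let $\mathcal D_{\mathrm{No}}^{n,t,\tau}$ be the uniform distribution on the functions $\mathbb Z_p^n\to\{-1,+1\}$ that are $(2-\tau)$-far from the class of functions $g$ with $\deg_p(g)=t$. **Theorem.** There is an absolute constant $c>0$ such that the following hold. 1. (Testing sparsity.) For every $0<\varepsilon<2$ there is an integer $K\ge 0$ depending only on $\varepsilon$ such that for every prime $p$ and all integers $s,n\ge0$ with $n\ge K(t+1)$, where $t=\lfloor\log_p s\rfloor$ (and $t=0$ if $s=0$), every adaptive $\varepsilon$-tester for $s$-sparsity on $\mathbb Z_p^n$ that makes at most $q$ queries satisfies $q\ge c\sqrt{s/p}$; if moreover $s$ is a power of $p$ (including $s=p^0=1$), then $q\ge c\sqrt s$. In particular, for each fixed $p$ the query complexity is $\Omega(\sqrt s)$. 2. (Indistinguishability.)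 For every $\tau>0$ there is an integer $C_0\ge 0$ depending only on $\tau$ such that for every integer $C\ge C_0$, every prime $p$ and every $t\ge1$, with $n=Ct$: there is at least one function that is $(2-\tau)$-far from the class $\deg_p=t$ (so $\mathcal D_{\mathrm{No}}^{n,t,\tau}$ is defined), and for every $d\ge 0$ with $d+t\le Ct$ (for instance $d=t$, or $d=(C-1)t$, the case in which $H$ has exactly $p^t$ cosets), (a) for every decision tree of depth less than $c\,p^{t/2}$, the distributions of the leaf reached on a random input from $\mathcal D_{\mathrm{Yes}}^{n,d}$ and from $\mathcal D_{\mathrm{No}}^{n,t,\tau}$ are within total variation distance $\frac13$; (b) every adaptive algorithm that makes at most $q$ queries and whose acceptance probabilities on $\mathcal D_{\mathrm{Yes}}^{n,d}$ and on $\mathcal D_{\mathrm{No}}^{n,t,\tau}$ differ by at least $\frac13$ satisfies $q\ge c\,p^{t/2}$. -/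

import Mathlib

/-! ### Boolean functions on `Z_p^n` and their Fourier sparsity -/

/-- Boolean-valued functions `Z_p^n → {-1, +1}`; the two signs are the units of `ℤ`. -/
abbrev BoolFn (p n : ℕ) : Type := (Fin n → ZMod p) → ℤˣ

/-- The Fourier coefficient `(1 / |G|) ∑ x, F x * conj (χ x)` of a function on a finite
Abelian group at a character `χ`. -/
noncomputable def groupFourierCoeff {G : Type*} [AddCommGroup G] [Fintype G]
    (F : G → ℂ) (χ : AddChar G ℂ) : ℂ :=
  (1 / (Fintype.card G : ℂ)) * ∑ x, F x * (starRingEnd ℂ) (χ x)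

/-- The Fourier sparsity of `f : G → {-1, +1}`: the number of nonzero Fourier coefficients. -/
noncomputable def sparsity {G : Type*} [AddCommGroup G] [Fintype G] (f : G → ℤˣ) : ℕ :=
  {χ : AddChar G ℂ | groupFourierCoeff (fun x => (((f x : ℤˣ) : ℤ) : ℂ)) χ ≠ 0}.ncard

/-- The set of `s`-sparse Boolean-valued functions on `Z_p^n`. -/
def sparseFns (p n s : ℕ) [NeZero p] : Set (BoolFn p n) :=
  {f | sparsity f ≤ s}

open scoped Classical in
/-- The degree over `Z_p`: the largest dimension of an affine subspace `V = x₀ + W` of `Z_p^n`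
(a nonempty solution set of a system of linear equations) such that the restriction of `f` to `V`
has full Fourier sparsity `p ^ dim V`. The restriction is viewed as the function
`w ↦ f (x₀ + w)` on the group `W`; another choice of `x₀` in `V` multiplies its Fourier
coefficients by numbers of modulus one. -/
noncomputable def degP {p n : ℕ} [Fact p.Prime] (f : BoolFn p n) : ℕ :=
  sSup {l : ℕ | ∃ (W : Submodule (ZMod p) (Fin n → ZMod p)) (x₀ : Fin n → ZMod p),
    Module.finrank (ZMod p) W = l ∧
      sparsity (fun w : W => f (x₀ + (w : Fin n → ZMod p))) = p ^ l}

/-- The square of the normalised `ℓ₂` distance, `E_x |f x - g x|^2`. -/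
noncomputable def sqDist {p n : ℕ} [NeZero p] (f g : BoolFn p n) : ℝ :=
  (1 / (Fintype.card (Fin n → ZMod p) : ℝ)) *
    ∑ x, ((((f x : ℤˣ) : ℤ) : ℝ) - (((g x : ℤˣ) : ℤ) : ℝ)) ^ 2

/-- `f` is `ε`-far in `ℓ₂` from every member of the class `P`. -/
def FarFrom {p n : ℕ} [NeZero p] (ε : ℝ) (P : Set (BoolFn p n)) (f : BoolFn p n) : Prop :=
  ∀ g ∈ P, ε ≤ sqDist f g

/-! ### Adaptive query algorithms -/

/-- Deterministic adaptive query algorithms with oracle access to a function `X → {-1, +1}`: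
decision trees whose inner nodes query a point of `X` and whose leaves accept (`true`) or
reject (`false`). -/
inductive DecisionTree (X : Type*) where
  | leaf (accept : Bool) : DecisionTree X
  | query (x : X) (next : ℤˣ → DecisionTree X) : DecisionTree X

namespace DecisionTree

variable {X : Type*}

/-- The worst-case number of queries. -/
def depth : DecisionTree X → ℕ
  | leaf _ => 0
  | query _ next => max (depth (next 1)) (depth (next (-1))) + 1

/-- The verdict on input `f`. -/
def eval : DecisionTree X → (X → ℤˣ) → Bool
  | leaf a, _ => a
  | query x next, f => eval (next (f x)) f

/-- The leaf reached on input `f`, given by the answers along the path that leads to it. -/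
def reachedLeaf : DecisionTree X → (X → ℤˣ) → List ℤˣ
  | leaf _, _ => []
  | query x next, f => f x :: reachedLeaf (next (f x)) f

end DecisionTree

/-- A randomized adaptive query algorithm: a probability distribution on decision trees. -/
abbrev QueryAlgorithm (X : Type*) : Type _ := PMF (DecisionTree X)

namespace QueryAlgorithm

variable {X : Type*}

/-- The algorithm makes at most `q` queries, on every input and for all outcomes of its coins. -/
def MakesAtMost (A : QueryAlgorithm X) (q : ℕ) : Prop :=
  ∀ T ∈ A.support, T.depth ≤ q

/-- The distribution of the verdict on input `f`. -/
noncomputable def verdict (A : QueryAlgorithm X) (f : X → ℤˣ) : PMF Bool :=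
  PMF.map (fun T => T.eval f) A

/-- The probability that the algorithm accepts an input drawn from `D`. -/
noncomputable def acceptProb (A : QueryAlgorithm X) (D : PMF (X → ℤˣ)) : ℝ :=
  ((D.bind fun f => A.verdict f) true).toReal

end QueryAlgorithm

/-- `A` is an `ε`-tester for the class `P`, with confidence `2/3`. -/
def IsTester {p n : ℕ} [NeZero p] (A : QueryAlgorithm (Fin n → ZMod p))
    (P : Set (BoolFn p n)) (ε : ℝ) : Prop :=
  (∀ f ∈ P, 2 / 3 ≤ (A.verdict f true).toReal) ∧
    ∀ f, FarFrom ε P f → 2 / 3 ≤ (A.verdict f false).toReal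

/-! ### The two distributions -/

/-- Total variation distance `sup_S |P(S) - Q(S)|`. -/
noncomputable def tvDist {α : Type*} (P Q : PMF α) : ℝ :=
  ⨆ S : Set α, |(P.toOuterMeasure S).toReal - (Q.toOuterMeasure S).toReal|

/-- The `d`-dimensional subspaces of `Z_p^n`. -/
noncomputable def subspacesOfDim (p n d : ℕ) [Fact p.Prime] :
    Finset (Submodule (ZMod p) (Fin n → ZMod p)) :=
  (Set.toFinite {H : Submodule (ZMod p) (Fin n → ZMod p) | Module.finrank (ZMod p) H = d}).toFinset

theorem subspacesOfDim_nonempty {p n d : ℕ} [Fact p.Prime] (hd : d ≤ n) :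
    (subspacesOfDim p n d).Nonempty := by
  have hli := (Pi.basisFun (ZMod p) (Fin n)).linearIndependent.comp
    (Fin.castLE hd) (Fin.castLE_injective hd)
  refine ⟨Submodule.span (ZMod p)
    (Set.range (Pi.basisFun (ZMod p) (Fin n) ∘ Fin.castLE hd)), ?_⟩
  have h := finrank_span_eq_card hli
  simpa [subspacesOfDim] using h

/-- The Boolean-valued functions that are constant on each coset of `H`. -/
noncomputable def cosetConstant {p n : ℕ} [Fact p.Prime]
    (H : Submodule (ZMod p) (Fin n → ZMod p)) : Finset (BoolFn p n) :=
  (Set.toFinite {f : BoolFn p n | ∀ x y, x - y ∈ H → f x = f y}).toFinset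

theorem cosetConstant_nonempty {p n : ℕ} [Fact p.Prime]
    (H : Submodule (ZMod p) (Fin n → ZMod p)) : (cosetConstant H).Nonempty :=
  ⟨fun _ => 1, by simp [cosetConstant]⟩

/-- Choose a uniformly random `d`-dimensional subspace `H` of `Z_p^n`, then a uniformly random
function constant on the cosets of `H` (an independent uniform sign on each coset). -/
noncomputable def yesDist (p n d : ℕ) [Fact p.Prime] (hd : d ≤ n) : PMF (BoolFn p n) :=
  (PMF.uniformOfFinset (subspacesOfDim p n d) (subspacesOfDim_nonempty hd)).bind fun H =>
    PMF.uniformOfFinset (cosetConstant H) (cosetConstant_nonempty H)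

/-- The functions on `Z_p^n` that are `ε`-far in `ℓ₂` from every function with `degP = t`. -/
noncomputable def farFromDeg (p n t : ℕ) [Fact p.Prime] (ε : ℝ) : Finset (BoolFn p n) :=
  (Set.toFinite {f : BoolFn p n | FarFrom ε {g | degP g = t} f}).toFinset

/-- A uniformly random function, conditioned on being `ε`-far in `ℓ₂` from every function with
`degP = t`. -/
noncomputable def noDist (p n t : ℕ) [Fact p.Prime] (ε : ℝ)
    (h : (farFromDeg p n t ε).Nonempty) : PMF (BoolFn p n) :=
  PMF.uniformOfFinset (farFromDeg p n t ε) h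

/-!
A sparse function is structured in a way that can be read off modulo `p`. If `f` restricted to an
`l`-dimensional flat, `l ≥ 2`, takes the value `-1` a number of times that is not divisible by `p`,
then reduction modulo the prime above `p` in `ℤ[ζ_p]` shows that no Fourier coefficient of the
restriction vanishes (`groupFourierCoeff_ne_zero_of_sum_signBit_ne_zero`). Hence if `f` has degree
at most `t`, or fewer than `p ^ (t + 1)` nonzero coefficients, the indicator `b` of `f = -1`,
read in `Z_p`, has sum zero on all flats of dimension `l = t + 2`. Dimension `t + 1` does not
suffice when `p = 2` and `t = 0`, which is why `t + 2` is used throughout.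

Such `b` form a small set. Group the coordinates into `⌊n / 2⌋` pairs. A monomial `x ^ a * y ^ b`
with `a + b < p` is a combination of powers of linear forms `x + m y`; applied in `l` pairs, this
makes every monomial with at least `l` light pairs (`a + b < p`) a combination of functions
invariant under an `l`-dimensional subspace, and these are orthogonal to `b`
(`SumsToZeroOnFlats.sum_mul_monomialFn_eq_zero`). As at least half of all exponent pairs are light,
at most `2 ^ l * (3 / 4) ^ ⌊n / 2⌋ * p ^ n` monomials remain (`card_few_lightPairs_le`). This bounds
the dimension of the code containing all `b`, and a `k`-dimensional code contains at most `2 ^ k`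
vectors with entries in `{0, 1}` (`card_le_two_pow_finrank`). For `n ≥ K (t + 1)` the resulting
count is beaten by the Chernoff bound `exp (-τ ^ 2 p ^ n / 8)` for the proportion of functions at
squared distance less than `2 - τ` from a given one, so at least `7 / 8` of all functions are far
from the class (`exists_forall_card_farFrom_ge`), with `K` independent of `p`.

Therefore the far functions are within `1 / 8` of the uniform distribution on all functions.
A random coset-constant function looks uniform as well: a nonzero vector lies in a random
`d`-dimensional subspace with probability at most `p ^ (-t)` when `d + t ≤ n`, so the at most `q`
points on the path to a given leaf lie in distinct cosets, and receive independent signs, with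
probability at least `1 - q ^ 2 / p ^ t` (`le_realProb_yesDist_reachedLeaf`). If
`q < p ^ (t / 2) / 3` this is at least `8 / 9`, and `1 / 9 + 1 / 8 < 1 / 4 < 1 / 3`. For the
testing bound take `d = n - t`: coset-constant functions are then `p ^ t`-sparse.
-/

section

open Finset Polynomial

/-! ### Fourier sparsity -/

/-- The `{0, 1}`-valued encoding of a sign: `1 ↦ 0` and `-1 ↦ 1`. -/
def signBit (R : Type*) [Zero R] [One R] (u : ℤˣ) : R := if u = 1 then 0 else 1

theorem groupFourierCoeff_eq_zero_iff {G : Type*} [AddCommGroup G] [Fintype G]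
    (F : G → ℂ) (χ : AddChar G ℂ) :
    groupFourierCoeff F χ = 0 ↔ ∑ x, F x * (starRingEnd ℂ) (χ x) = 0 := by
  have : (Fintype.card G : ℂ) ≠ 0 := by exact_mod_cast Fintype.card_ne_zero
  simp [groupFourierCoeff]

/-- Reduction modulo the prime above `p`: an integer combination of powers of a primitive `p`-th
root of unity that happens to be an integer is congruent modulo `p` to the sum of its
coefficients, because `Φ_p` divides the difference and `Φ_p(1) = p`. -/
theorem prime_dvd_eval_one_sub_of_aeval_eq_intCast {p : ℕ} [hp : Fact p.Prime] {ζ : ℂ}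
    (hζ : IsPrimitiveRoot ζ p) (P : ℤ[X]) (k : ℤ) (h : aeval ζ P = (k : ℂ)) :
    (p : ℤ) ∣ P.eval 1 - k := by
  have h1 : minpoly ℤ ζ ∣ P - C k :=
    minpoly.isIntegrallyClosed_dvd (hζ.isIntegral hp.out.pos) (by simp [h])
  rw [← cyclotomic_eq_minpoly hζ hp.out.pos] at h1
  have h2 := eval_dvd (x := (1 : ℤ)) h1
  simpa [eval_one_cyclotomic_prime] using h2

/-- If the number of `-1`s of a sign function on a group of order `p ^ l`, `l ≥ 2`, and exponent
`p` is not divisible by `p`, then no Fourier coefficient vanishes. For `p = 2` the hypothesis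
`2 ≤ l` is needed: a function on two points always has a vanishing coefficient. -/
theorem groupFourierCoeff_ne_zero_of_sum_signBit_ne_zero {p l : ℕ} [hp : Fact p.Prime]
    {G : Type*} [AddCommGroup G] [Fintype G] (hG : ∀ x : G, p • x = 0) (hl : 2 ≤ l)
    (hcard : Fintype.card G = p ^ l) (f : G → ℤˣ) (hf : ∑ x, signBit (ZMod p) (f x) ≠ 0)
    (χ : AddChar G ℂ) : groupFourierCoeff (fun x => (((f x : ℤˣ) : ℤ) : ℂ)) χ ≠ 0 := by
  classical
  intro h0
  rw [groupFourierCoeff_eq_zero_iff] at h0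
  apply hf
  have hζ := Complex.isPrimitiveRoot_exp p hp.out.ne_zero
  set ζ := Complex.exp (2 * Real.pi * Complex.I / p)
  have hroot : ∀ x, ∃ i < p, ζ ^ i = χ (-x) := fun x =>
    hζ.eq_pow_of_pow_eq_one (by rw [← AddChar.map_nsmul_eq_pow, smul_neg, hG]; simp)
  choose c hc hcζ using hroot
  have hconj : ∀ x, (starRingEnd ℂ) (χ x) = ζ ^ c x := fun x => by
    rw [hcζ, AddChar.map_neg_eq_conj]
  let P : ℤ[X] := ∑ x, C (signBit ℤ (f x)) * X ^ c x
  have hP1 : P.eval 1 = ∑ x, signBit ℤ (f x) := by simp [P, eval_finsetSum]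
  have hPζ : aeval ζ P = ∑ x, (signBit ℤ (f x) : ℂ) * ζ ^ c x := by simp [P]
  have hsign : ∀ u : ℤˣ, ((u : ℤ) : ℂ) = 1 - 2 * (signBit ℤ u : ℂ) := fun u => by
    rcases Int.units_eq_one_or u with rfl | rfl <;> norm_num [signBit]
  obtain ⟨m, hm⟩ : ∃ m : ℤ, ∑ x, ζ ^ c x = (p : ℂ) ^ 2 * m := by
    have h1 : ∑ x, ζ ^ c x = ∑ x, χ x := by
      simp_rw [hcζ]
      exact Fintype.sum_equiv (Equiv.neg G) _ _ fun x => rfl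
    rw [h1, AddChar.sum_eq_ite]
    split_ifs with h
    · refine ⟨p ^ (l - 2), ?_⟩
      rw [hcard]
      push_cast
      rw [← pow_add, Nat.add_sub_cancel' hl]
    · exact ⟨0, by simp⟩
  have h2 : 2 * aeval ζ P = (p : ℂ) ^ 2 * m := by
    rw [← hm, hPζ]
    simp_rw [hsign, hconj, sub_mul, one_mul, Finset.sum_sub_distrib] at h0
    rw [sub_eq_zero] at h0
    rw [h0, mul_sum]
    simp_rw [mul_assoc]
  have hdvd : (p : ℤ) ∣ ∑ x, signBit ℤ (f x) := by
    rcases hp.out.eq_two_or_odd' with rfl | hodd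
    · have h3 := prime_dvd_eval_one_sub_of_aeval_eq_intCast hζ P (2 * m) (by
        push_cast at h2 ⊢
        linear_combination h2 / 2)
      rw [hP1] at h3
      have h4 : ((2 : ℕ) : ℤ) ∣ 2 * m := ⟨m, by simp⟩
      exact (dvd_sub_left h4).1 h3
    · have h3 := prime_dvd_eval_one_sub_of_aeval_eq_intCast hζ (2 * P) (p ^ 2 * m) (by
        rw [map_mul, map_ofNat, h2]
        push_cast
        rfl)
      have h4 : (p : ℤ) ∣ p ^ 2 * m := ⟨p * m, by ring⟩
      have h5 := (dvd_sub_left h4).1 h3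
      simp only [eval_mul, eval_ofNat, hP1] at h5
      refine (Int.prime_iff_natAbs_prime.2 (by simpa using hp.out)).dvd_mul.1 h5 |>.resolve_left ?_
      intro h6
      have h7 : p ∣ 2 := by exact_mod_cast h6
      have h8 := (Nat.prime_dvd_prime_iff_eq hp.out Nat.prime_two).1 h7
      subst h8
      exact absurd hodd (by decide)
  have h9 := (ZMod.intCast_zmod_eq_zero_iff_dvd _ p).2 hdvd
  rw [Int.cast_sum] at h9
  rw [← h9]
  refine Finset.sum_congr rfl fun x _ => ?_
  unfold signBit
  split_ifs <;> simp

theorem sparsity_eq_card {p l : ℕ} [hp : Fact p.Prime]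
    {G : Type*} [AddCommGroup G] [Fintype G] (hG : ∀ x : G, p • x = 0) (hl : 2 ≤ l)
    (hcard : Fintype.card G = p ^ l) (f : G → ℤˣ) (hf : ∑ x, signBit (ZMod p) (f x) ≠ 0) :
    sparsity f = p ^ l := by
  have : {χ : AddChar G ℂ | groupFourierCoeff (fun x => (((f x : ℤˣ) : ℤ) : ℂ)) χ ≠ 0}
      = Set.univ :=
    Set.eq_univ_of_forall fun χ =>
      groupFourierCoeff_ne_zero_of_sum_signBit_ne_zero hG hl hcard f hf χ
  rw [sparsity, this, Set.ncard_univ, Nat.card_eq_fintype_card, AddChar.card_eq, hcard]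

theorem fourier_inversion {G : Type*} [AddCommGroup G] [Fintype G] (F : G → ℂ) (x : G) :
    F x = ∑ χ : AddChar G ℂ, groupFourierCoeff F χ * χ x := by
  classical
  have hG : (Fintype.card G : ℂ) ≠ 0 := by exact_mod_cast Fintype.card_ne_zero
  have h : ∀ y, ∑ χ : AddChar G ℂ, (starRingEnd ℂ) (χ y) * χ x
      = if x - y = 0 then (Fintype.card G : ℂ) else 0 := fun y => by
    rw [← AddChar.sum_apply_eq_ite]
    refine Finset.sum_congr rfl fun χ _ => ?_
    rw [← AddChar.map_neg_eq_conj, ← AddChar.map_add_eq_mul]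
    congr 1
    abel
  simp_rw [groupFourierCoeff, mul_assoc, ← mul_sum, sum_mul, mul_assoc]
  rw [sum_comm]
  simp_rw [← mul_sum, h, sub_eq_zero]
  simp
  field_simp

/-- Restricting to a coset of a subgroup does not increase the sparsity: every character in the
Fourier support of the restriction is the restriction of one in the support. -/
theorem sparsity_restrict_le {G W : Type*} [AddCommGroup G] [Fintype G] [AddCommGroup W]
    [Fintype W] (φ : W →+ G) (x₀ : G) (f : G → ℤˣ) :
    sparsity (fun w => f (x₀ + φ w)) ≤ sparsity f := by
  classical
  unfold sparsity
  refine le_trans (Set.ncard_le_ncard (t := (fun χ : AddChar G ℂ => χ.compAddMonoidHom φ) ''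
    {χ : AddChar G ℂ | groupFourierCoeff (fun x => (((f x : ℤˣ) : ℤ) : ℂ)) χ ≠ 0}) ?_
    (Set.toFinite _)) (Set.ncard_image_le (Set.toFinite _))
  intro ψ hψ
  by_contra hcon
  apply hψ
  rw [groupFourierCoeff_eq_zero_iff]
  simp_rw [fourier_inversion (fun x => (((f x : ℤˣ) : ℤ) : ℂ)) (x₀ + _), sum_mul]
  rw [sum_comm]
  refine Finset.sum_eq_zero fun χ _ => ?_
  by_cases hχ : groupFourierCoeff (fun x => (((f x : ℤˣ) : ℤ) : ℂ)) χ = 0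
  · simp [hχ]
  have hne : χ.compAddMonoidHom φ - ψ ≠ 0 := fun h =>
    hcon ⟨χ, hχ, sub_eq_zero.1 h⟩
  have h0 := (AddChar.sum_eq_zero_iff_ne_zero (ψ := χ.compAddMonoidHom φ - ψ)).2 hne
  have : ∀ w, groupFourierCoeff (fun x => (((f x : ℤˣ) : ℤ) : ℂ)) χ * χ (x₀ + φ w) *
      (starRingEnd ℂ) (ψ w) = (groupFourierCoeff (fun x => (((f x : ℤˣ) : ℤ) : ℂ)) χ * χ x₀) *
        (χ.compAddMonoidHom φ - ψ) w := fun w => by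
    rw [AddChar.map_add_eq_mul, AddChar.sub_apply', ← AddChar.map_neg_eq_conj,
      AddChar.map_neg_eq_inv, AddChar.compAddMonoidHom_apply]
    ring
  rw [Finset.sum_congr rfl fun w _ => this w, ← mul_sum, h0, mul_zero]

/-- The Fourier support of a function constant on the cosets of `H` consists of characters of the
quotient. -/
theorem sparsity_le_card_quotient {G : Type*} [AddCommGroup G] [Fintype G] (H : AddSubgroup G)
    (f : G → ℤˣ) (hf : ∀ x y, x - y ∈ H → f x = f y) :
    sparsity f ≤ Nat.card (G ⧸ H) := by
  classical
  have hfin : Finite (G ⧸ H) := inferInstance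
  have := Fintype.ofFinite (G ⧸ H)
  have hcard : Nat.card (G ⧸ H) = (Set.univ : Set (AddChar (G ⧸ H) ℂ)).ncard := by
    rw [Set.ncard_univ, Nat.card_eq_fintype_card, Nat.card_eq_fintype_card, AddChar.card_eq]
  rw [hcard]
  unfold sparsity
  refine le_trans (Set.ncard_le_ncard (t := (fun ψ : AddChar (G ⧸ H) ℂ =>
    ψ.compAddMonoidHom (QuotientAddGroup.mk' H)) '' Set.univ) ?_ (Set.toFinite _))
    (Set.ncard_image_le (Set.toFinite _))
  intro χ hχ
  have htriv : ∀ h ∈ H, χ h = 1 := by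
    intro h hh
    by_contra hne
    apply hχ
    rw [groupFourierCoeff_eq_zero_iff]
    set S := ∑ x, (((f x : ℤˣ) : ℤ) : ℂ) * (starRingEnd ℂ) (χ x) with hS
    have h1 : S = S * (starRingEnd ℂ) (χ h) := by
      rw [hS, sum_mul]
      refine (Fintype.sum_equiv (Equiv.addRight h) _ _ fun x => ?_).symm
      rw [Equiv.coe_addRight, hf (x + h) x (by simpa using hh), AddChar.map_add_eq_mul, map_mul,
        mul_assoc]
    have h2 : (starRingEnd ℂ) (χ h) ≠ 1 := fun h3 => hne (by
      simpa using congrArg (starRingEnd ℂ) h3)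
    by_contra hS0
    exact h2 (mul_left_cancel₀ hS0 (by rw [mul_one]; exact h1.symm))
  let ψ : AddChar (G ⧸ H) ℂ := AddChar.toAddMonoidHomEquiv.symm
    (QuotientAddGroup.lift H (AddChar.toAddMonoidHomEquiv χ) (fun h hh => by
      have := htriv h hh
      simpa [AddMonoidHom.mem_ker] using this))
  exact ⟨ψ, Set.mem_univ _, by ext x; rfl⟩

/-! ### Functions summing to zero on flats are orthogonal to most monomials -/

open scoped Classical in
/-- The function `g` has sum zero on every `l`-dimensional affine subspace `x₀ + W`. -/
def SumsToZeroOnFlats {K ι : Type*} [Field K] [Fintype K] [Fintype ι] [DecidableEq ι] (l : ℕ)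
    (g : (ι → K) → K) : Prop :=
  ∀ W : Submodule K (ι → K), Module.finrank K W = l → ∀ x₀, ∑ x with x - x₀ ∈ W, g x = 0

theorem SumsToZeroOnFlats.sum_mul_eq_zero {K ι : Type*} [Field K] [Fintype K] [Fintype ι]
    [DecidableEq ι] {l : ℕ}
    {g : (ι → K) → K} (hg : SumsToZeroOnFlats l g) (W : Submodule K (ι → K))
    (hW : Module.finrank K W = l) (h : (ι → K) → K) (hh : ∀ x, ∀ w ∈ W, h (x + w) = h x) :
    ∑ x, g x * h x = 0 := by
  classical
  have : Fintype ((ι → K) ⧸ W) := Fintype.ofFinite _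
  rw [← Finset.sum_fiberwise univ (fun x => W.mkQ x)]
  refine Finset.sum_eq_zero fun q _ => ?_
  obtain ⟨x₀, rfl⟩ := W.mkQ_surjective q
  have h1 : ∀ x ∈ univ.filter (fun x => W.mkQ x = W.mkQ x₀), g x * h x = g x * h x₀ := by
    intro x hx
    have h2 : x - x₀ ∈ W := by simpa [Submodule.Quotient.eq] using hx
    rw [← hh x₀ _ h2, add_sub_cancel]
  rw [Finset.sum_congr rfl h1, ← sum_mul]
  have h2 := hg W hW x₀
  have h3 : univ.filter (fun x => W.mkQ x = W.mkQ x₀) = univ.filter (fun x => x - x₀ ∈ W) := by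
    ext x
    simp [Submodule.Quotient.eq]
  rw [h3]
  convert zero_mul _

/-- Each monomial of degree less than `p` in two variables is a combination of powers of the linear
forms `x + m y`: extract a coefficient of the polynomial `(x + y T) ^ (a + b)` in `T` by Lagrange
interpolation. -/
theorem exists_monomial_eq_sum_linear_pow {p : ℕ} [hp : Fact p.Prime] (a b : ℕ) (hab : a + b < p) :
    ∃ α : ZMod p → ZMod p, ∀ x y : ZMod p,
      x ^ a * y ^ b = ∑ m, α m * (x + m * y) ^ (a + b) := by
  classical
  refine ⟨fun m => ((a + b).choose b : ZMod p)⁻¹ *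
    (Lagrange.basis univ (id : ZMod p → ZMod p) m).coeff b, fun x y => ?_⟩
  have hch : ((a + b).choose b : ZMod p) ≠ 0 := by
    rw [Ne, ZMod.natCast_eq_zero_iff]
    intro h
    have h1 := (hp.out.dvd_factorial).1 ((h.mul_right (b.factorial)).trans
      ⟨a.factorial, by
        rw [← Nat.add_choose_mul_factorial_mul_factorial a b, mul_right_comm]⟩)
    omega
  let Q : (ZMod p)[X] := (C x + C y * X) ^ (a + b)
  have hQ : Q = ∑ m : ZMod p, C (Q.eval m) * Lagrange.basis univ id m := by
    have h1 : Q.degree < ((univ : Finset (ZMod p)).card : WithBot ℕ) := by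
      rw [card_univ, ZMod.card]
      have h2 : (C x + C y * X).natDegree ≤ 1 := by compute_degree
      refine lt_of_le_of_lt (degree_le_of_natDegree_le (natDegree_pow_le_of_le (a + b) h2)) ?_
      rw [mul_one]
      exact_mod_cast hab
    have h2 := Lagrange.eq_interpolate (v := (id : ZMod p → ZMod p)) (Set.injOn_id _) h1
    rw [Lagrange.interpolate_apply] at h2
    exact h2
  have hcoeff : Q.coeff b = (a + b).choose b * (x ^ a * y ^ b) := by
    have h1 : Q = ∑ i ∈ range (a + b + 1),
        C (x ^ (a + b - i) * y ^ i * (a + b).choose i) * X ^ i := by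
      simp only [Q]
      rw [add_comm (C x), add_pow]
      refine Finset.sum_congr rfl fun i _ => ?_
      rw [mul_pow]
      simp only [C_mul, C_pow, C_eq_natCast]
      ring
    rw [h1, finsetSum_coeff]
    simp only [coeff_C_mul_X_pow]
    rw [Finset.sum_eq_single b]
    · simp only [if_true, Nat.add_sub_cancel]
      ring
    · intro i _ hi
      simp [hi.symm]
    · intro h
      exact absurd (mem_range.2 (by omega)) h
  have h3 := congrArg (fun P => P.coeff b) hQ
  simp only [finsetSum_coeff, coeff_C_mul, hcoeff] at h3
  simp_rw [mul_assoc]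
  rw [← mul_right_inj' hch, h3, mul_sum]
  refine Finset.sum_congr rfl fun m _ => ?_
  simp only [Q, eval_pow, eval_add, eval_mul, eval_C, eval_X]
  field_simp

theorem exists_delta_eq_sum_pow {p : ℕ} [hp : Fact p.Prime] (y : ZMod p) :
    ∃ β : Fin p → ZMod p, ∀ x : ZMod p, (if x = y then 1 else 0) = ∑ k, β k * x ^ (k : ℕ) := by
  let Q : (ZMod p)[X] := 1 - (X - C y) ^ (p - 1)
  have hdeg : Q.natDegree < p := by
    have h1 : Q.natDegree ≤ p - 1 := by
      refine (natDegree_sub_le _ _).trans (max_le ?_ ?_)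
      · rw [natDegree_one]
        exact Nat.zero_le _
      exact (natDegree_pow_le_of_le (p - 1) (natDegree_X_sub_C_le y)).trans (by simp)
    have := hp.out.pos
    omega
  refine ⟨fun k => Q.coeff k, fun x => ?_⟩
  rw [Fin.sum_univ_eq_sum_range (fun k => Q.coeff k * x ^ k) p, ← eval_eq_sum_range' hdeg]
  simp only [Q, eval_sub, eval_one, eval_pow, eval_X, eval_C]
  split_ifs with h
  · subst h
    rw [sub_self, zero_pow (Nat.sub_ne_zero_of_lt hp.out.one_lt), sub_zero]
  · rw [ZMod.pow_card_sub_one_eq_one (sub_ne_zero.2 h), sub_self]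

/-- The reduced monomial with exponent vector `e`, as a function on `Z_p^ι`. -/
def monomialFn {p : ℕ} {ι : Type*} [Fintype ι] (e : ι → Fin p) (x : ι → ZMod p) : ZMod p :=
  ∏ i, x i ^ (e i : ℕ)

/-- The reduced monomials span all functions on `Z_p^ι`: they span the point indicators. -/
theorem eq_zero_of_sum_mul_monomialFn_eq_zero {p : ℕ} [Fact p.Prime] {ι : Type*} [Fintype ι]
    [DecidableEq ι] (g : (ι → ZMod p) → ZMod p)
    (h : ∀ e : ι → Fin p, ∑ x, g x * monomialFn e x = 0) : g = 0 := by
  classical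
  funext y
  choose β hβ using fun i => exists_delta_eq_sum_pow (y i)
  have hδ : ∀ x : ι → ZMod p, (if x = y then (1 : ZMod p) else 0)
      = ∑ e : ι → Fin p, (∏ i, β i (e i)) * monomialFn e x := by
    intro x
    have h1 : (if x = y then (1 : ZMod p) else 0) = ∏ i, if x i = y i then 1 else 0 := by
      rw [Fintype.prod_ite_zero]
      simp [funext_iff]
    rw [h1, Finset.prod_congr rfl fun i _ => hβ i (x i), Fintype.prod_sum]
    exact Finset.sum_congr rfl fun e _ => Finset.prod_mul_distrib
  have h2 : g y = ∑ x, g x * (if x = y then (1 : ZMod p) else 0) := by simp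
  rw [h2]
  simp_rw [hδ, mul_sum]
  rw [sum_comm]
  refine Finset.sum_eq_zero fun e _ => ?_
  rw [← mul_zero (∏ i, β i (e i)), ← h e, mul_sum]
  exact Finset.sum_congr rfl fun x _ => by ring

/-- The coordinates being grouped into pairs indexed by `J` and remaining ones indexed by `R`, the
pairs in which the two exponents of `e` add up to less than `p`. -/
def lightPairs {p : ℕ} {ι J R : Type*} [Fintype J] (σ : (J ⊕ J) ⊕ R ≃ ι) (e : ι → Fin p) :
    Finset J :=
  univ.filter fun j => (e (σ (.inl (.inl j))) : ℕ) + (e (σ (.inl (.inr j))) : ℕ) < p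

/-- In `l` of the light pairs expand the monomial into powers of linear forms `x + m y`. Each
resulting product is invariant under an `l`-dimensional subspace. -/
theorem SumsToZeroOnFlats.sum_mul_monomialFn_eq_zero {p : ℕ} [Fact p.Prime] {ι J R : Type*}
    [Fintype ι] [DecidableEq ι] [Fintype J] [Fintype R] (σ : (J ⊕ J) ⊕ R ≃ ι) {l : ℕ}
    {g : (ι → ZMod p) → ZMod p} (hg : SumsToZeroOnFlats l g) (e : ι → Fin p)
    (he : l ≤ (lightPairs σ e).card) : ∑ x, g x * monomialFn e x = 0 := by
  classical
  obtain ⟨S, hS, hSl⟩ := exists_subset_card_eq he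
  let u : J → ι := fun j => σ (.inl (.inl j))
  let v : J → ι := fun j => σ (.inl (.inr j))
  have hα : ∀ j : S, ∃ α : ZMod p → ZMod p, ∀ x y : ZMod p,
      x ^ (e (u j) : ℕ) * y ^ (e (v j) : ℕ)
        = ∑ m, α m * (x + m * y) ^ ((e (u j) : ℕ) + (e (v j) : ℕ)) := fun j =>
    exists_monomial_eq_sum_linear_pow _ _ (mem_filter.1 (hS j.2)).2
  choose α hα using hα
  let rest : (ι → ZMod p) → ZMod p := fun x =>
    (∏ j ∈ univ \ S, x (u j) ^ (e (u j) : ℕ) * x (v j) ^ (e (v j) : ℕ)) *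
      ∏ r, x (σ (.inr r)) ^ (e (σ (.inr r)) : ℕ)
  let h : (S → ZMod p) → (ι → ZMod p) → ZMod p := fun m x =>
    (∏ j : S, (x (u j) + m j * x (v j)) ^ ((e (u j) : ℕ) + (e (v j) : ℕ))) * rest x
  have hmono : ∀ x, monomialFn e x = ∑ m : S → ZMod p, (∏ j, α j (m j)) * h m x := by
    intro x
    have h1 : monomialFn e x
        = (∏ j : S, x (u j) ^ (e (u j) : ℕ) * x (v j) ^ (e (v j) : ℕ)) * rest x := by
      have h2 : (∏ j : S, x (u j) ^ (e (u j) : ℕ) * x (v j) ^ (e (v j) : ℕ))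
          = ∏ j ∈ S, x (u j) ^ (e (u j) : ℕ) * x (v j) ^ (e (v j) : ℕ) :=
        Finset.prod_coe_sort S (fun j => x (u j) ^ (e (u j) : ℕ) * x (v j) ^ (e (v j) : ℕ))
      rw [h2, ← mul_assoc, mul_comm (∏ j ∈ S, _), Finset.prod_sdiff (subset_univ S),
        Finset.prod_mul_distrib, monomialFn, ← σ.prod_comp, Fintype.prod_sum_type,
        Fintype.prod_sum_type]
    rw [h1, Finset.prod_congr rfl fun j _ => hα j _ _, Fintype.prod_sum, sum_mul]
    refine Finset.sum_congr rfl fun m _ => ?_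
    rw [Finset.prod_mul_distrib, mul_assoc]
  simp_rw [hmono, mul_sum]
  rw [sum_comm]
  refine Finset.sum_eq_zero fun m _ => ?_
  -- The range of `L` is the subspace on which the forms `x (u j) + m j * x (v j)` for `j ∈ S`
  -- and all coordinates outside the pairs in `S` vanish.
  let L : (S → ZMod p) →ₗ[ZMod p] (ι → ZMod p) := LinearMap.pi fun i =>
    match σ.symm i with
    | .inl (.inl j) => if hj : j ∈ S then (-(m ⟨j, hj⟩)) • LinearMap.proj ⟨j, hj⟩ else 0
    | .inl (.inr j) => if hj : j ∈ S then LinearMap.proj ⟨j, hj⟩ else 0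
    | .inr _ => 0
  have hLu : ∀ c (j : J) (hj : j ∈ S), L c (u j) = -(m ⟨j, hj⟩) * c ⟨j, hj⟩ := by
    intro c j hj
    simp [L, u, hj]
  have hLv : ∀ c (j : J) (hj : j ∈ S), L c (v j) = c ⟨j, hj⟩ := by
    intro c j hj
    simp [L, v, hj]
  have hLu' : ∀ c (j : J), j ∉ S → L c (u j) = 0 := by
    intro c j hj
    simp [L, u, hj]
  have hLv' : ∀ c (j : J), j ∉ S → L c (v j) = 0 := by
    intro c j hj
    simp [L, v, hj]
  have hLr : ∀ c r, L c (σ (.inr r)) = 0 := by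
    intro c r
    simp [L]
  have hinj : Function.Injective L := by
    intro c c' hcc
    funext j
    rw [← hLv c j j.2, ← hLv c' j j.2, hcc]
  have hfr : Module.finrank (ZMod p) (LinearMap.range L) = l := by
    rw [LinearMap.finrank_range_of_inj hinj, Module.finrank_fintype_fun_eq_card,
      Fintype.card_coe, hSl]
  have h3 := hg.sum_mul_eq_zero (LinearMap.range L) hfr (h m) (by
    rintro x _ ⟨c, rfl⟩
    simp only [h, rest, Pi.add_apply, hLr, add_zero]
    congr 1
    · refine Finset.prod_congr rfl fun j _ => ?_
      rw [hLu c j j.2, hLv c j j.2]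
      congr 1
      ring
    · congr 1
      refine Finset.prod_congr rfl fun j hj => ?_
      rw [hLu' c j (mem_sdiff.1 hj).2, hLv' c j (mem_sdiff.1 hj).2, add_zero, add_zero])
  rw [← mul_zero (∏ j, α j (m j)), ← h3, mul_sum]
  exact Finset.sum_congr rfl fun x _ => by ring

/-! ### Counting sign functions in a linear code -/

/-- A `k`-dimensional space of functions is determined by its values at `k` points. -/
theorem card_le_two_pow_finrank {K X : Type*} [Field K] [Finite X] (A : Submodule K (X → K))
    (F : Finset (X → ℤˣ)) (hF : ∀ f ∈ F, (fun x => signBit K (f x)) ∈ A) :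
    F.card ≤ 2 ^ Module.finrank K A := by
  classical
  let φ : X → Module.Dual K A := fun x => LinearMap.proj x ∘ₗ A.subtype
  obtain ⟨κ, a, -, hspan, hli⟩ := exists_linearIndependent' K φ
  have : Finite κ := hli.finite
  have := Fintype.ofFinite κ
  have hκ : Fintype.card κ ≤ Module.finrank K A := by
    rw [← Subspace.dual_finrank_eq]
    exact hli.fintype_card_le_finrank
  have hinj : Set.InjOn (fun (f : X → ℤˣ) (k : κ) => f (a k)) F := by
    intro f hf f' hf' hff
    let d : A := ⟨_, hF f hf⟩ - ⟨_, hF f' hf'⟩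
    have hd : ∀ x, d.1 x = signBit K (f x) - signBit K (f' x) := fun x => rfl
    have hker : Submodule.span K (Set.range φ) ≤ LinearMap.ker (Module.Dual.eval K A d) := by
      rw [← hspan, Submodule.span_le]
      rintro _ ⟨k, rfl⟩
      have := congrFun hff k
      simp only at this
      change d.1 (a k) = 0
      rw [hd, this, sub_self]
    funext x
    have h1 : d.1 x = 0 := hker (Submodule.subset_span ⟨x, rfl⟩)
    rw [hd, sub_eq_zero] at h1
    unfold signBit at h1
    rcases Int.units_eq_one_or (f x) with h2 | h2 <;>
      rcases Int.units_eq_one_or (f' x) with h3 | h3 <;> simp_all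
  calc F.card ≤ (univ : Finset (κ → ℤˣ)).card :=
        card_le_card_of_injOn _ (fun _ _ => by simp) hinj
    _ = 2 ^ Fintype.card κ := by simp
    _ ≤ _ := Nat.pow_le_pow_right two_pos hκ

/-- The functions orthogonal to all monomials with at least `l` light pairs form a space whose
dimension is at most the number of remaining monomials. -/
theorem card_signFns_sumsToZeroOnFlats_le {p : ℕ} [Fact p.Prime] {ι J R : Type*}
    [Fintype ι] [DecidableEq ι] [Fintype J] [Fintype R] (σ : (J ⊕ J) ⊕ R ≃ ι) (l : ℕ)
    (F : Finset ((ι → ZMod p) → ℤˣ))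
    (hF : ∀ f ∈ F, SumsToZeroOnFlats l fun x => signBit (ZMod p) (f x)) :
    F.card ≤ 2 ^ Fintype.card {e : ι → Fin p // (lightPairs σ e).card < l} := by
  classical
  let A : Submodule (ZMod p) ((ι → ZMod p) → ZMod p) :=
    { carrier := {g | ∀ e : ι → Fin p, l ≤ (lightPairs σ e).card → ∑ x, g x * monomialFn e x = 0}
      add_mem' := fun {a b} ha hb e he => by
        simp [add_mul, Finset.sum_add_distrib, ha e he, hb e he]
      zero_mem' := fun e he => by simp
      smul_mem' := fun c a ha e he => by
        simp [mul_assoc, ← mul_sum, ha e he] }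
  let Φ : A →ₗ[ZMod p] ({e : ι → Fin p // (lightPairs σ e).card < l} → ZMod p) :=
    { toFun := fun g e => ∑ x, g.1 x * monomialFn e.1 x
      map_add' := fun a b => by
        funext e
        simp [add_mul, Finset.sum_add_distrib]
      map_smul' := fun c a => by
        funext e
        simp [mul_assoc, ← mul_sum] }
  have hΦ : Function.Injective Φ := by
    rw [← LinearMap.ker_eq_bot, LinearMap.ker_eq_bot']
    intro g hg
    refine Subtype.ext (eq_zero_of_sum_mul_monomialFn_eq_zero g.1 fun e => ?_)
    rcases lt_or_ge (lightPairs σ e).card l with h | h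
    · exact congrFun hg ⟨e, h⟩
    · exact g.2 e h
  refine (card_le_two_pow_finrank A F fun f hf e he =>
    (hF f hf).sum_mul_monomialFn_eq_zero σ e he).trans (Nat.pow_le_pow_right two_pos ?_)
  have := LinearMap.finrank_le_finrank_of_injective hΦ
  rwa [Module.finrank_fintype_fun_eq_card] at this

theorem sum_lightWeight_le (p : ℕ) :
    ∑ a : Fin p × Fin p, (if (a.1 : ℕ) + (a.2 : ℕ) < p then (1 / 2 : ℝ) else 1)
      ≤ 3 / 4 * (p : ℝ) ^ 2 := by
  set w : Fin p × Fin p → ℝ := fun a : Fin p × Fin p =>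
    if (a.1 : ℕ) + (a.2 : ℕ) < p then (1 / 2 : ℝ) else 1
  -- The involution `(a, b) ↦ (p - 1 - a, p - 1 - b)` makes heavy pairs light.
  have h1 : ∑ a, w a = ∑ a : Fin p × Fin p, w (Fin.rev a.1, Fin.rev a.2) :=
    (Fintype.sum_equiv (Equiv.prodCongr Fin.revPerm Fin.revPerm) _ w fun _ => rfl).symm
  have h2 : ∀ a, w a + w (Fin.rev a.1, Fin.rev a.2) ≤ 3 / 2 := by
    rintro ⟨a, b⟩
    simp only [w, Fin.val_rev]
    split_ifs with h3 h4 h4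
    · norm_num
    · norm_num
    · norm_num
    · omega
  have h3 : ∑ a, (w a + w (Fin.rev a.1, Fin.rev a.2)) ≤ ∑ _a : Fin p × Fin p, (3 / 2 : ℝ) :=
    Finset.sum_le_sum fun a _ => h2 a
  rw [Finset.sum_add_distrib, ← h1] at h3
  simp at h3
  nlinarith

/-- Exponential-moment bound: with weight `1 / 2` for each light pair, an exponent vector with
fewer than `l` light pairs has weight at least `2 ^ (-l)`, and the total weight factors over the
pairs. -/
theorem card_few_lightPairs_le {p : ℕ} {ι J R : Type*} [Fintype ι] [DecidableEq ι]
    [Fintype J] [Fintype R] (σ : (J ⊕ J) ⊕ R ≃ ι) (l : ℕ) :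
    (Fintype.card {e : ι → Fin p // (lightPairs σ e).card < l} : ℝ)
      ≤ 2 ^ l * (3 / 4) ^ Fintype.card J * (p : ℝ) ^ Fintype.card ι := by
  classical
  let w : Fin p → Fin p → ℝ := fun a b => if (a : ℕ) + (b : ℕ) < p then (1 / 2 : ℝ) else 1
  have hw : ∀ e : ι → Fin p, ∏ j, w (e (σ (.inl (.inl j)))) (e (σ (.inl (.inr j))))
      = (1 / 2) ^ (lightPairs σ e).card := by
    intro e
    simp only [w, lightPairs]
    rw [Finset.prod_ite]
    simp
  have h1 : (Fintype.card {e : ι → Fin p // (lightPairs σ e).card < l} : ℝ)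
      ≤ ∑ e : ι → Fin p, 2 ^ l * ∏ j, w (e (σ (.inl (.inl j)))) (e (σ (.inl (.inr j)))) := by
    rw [Fintype.card_subtype, card_filter]
    push_cast
    refine Finset.sum_le_sum fun e _ => ?_
    rw [hw]
    split_ifs with h
    · rw [one_div, inv_pow, ← div_eq_mul_inv, one_le_div (by positivity)]
      exact pow_le_pow_right₀ (by norm_num) h.le
    · positivity
  have h2 : ∑ e : ι → Fin p, ∏ j, w (e (σ (.inl (.inl j)))) (e (σ (.inl (.inr j))))
      = (p : ℝ) ^ Fintype.card R * (∑ a : Fin p × Fin p, w a.1 a.2) ^ Fintype.card J := by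
    let E : (ι → Fin p) ≃ (J → Fin p × Fin p) × (R → Fin p) :=
      (σ.symm.arrowCongr (Equiv.refl _)).trans ((Equiv.sumArrowEquivProdArrow _ _ _).trans
        (Equiv.prodCongr ((Equiv.sumArrowEquivProdArrow _ _ _).trans
          (Equiv.arrowProdEquivProdArrow _ _ _).symm) (Equiv.refl _)))
    have h3 : ∑ e : ι → Fin p, ∏ j, w (e (σ (.inl (.inl j)))) (e (σ (.inl (.inr j))))
        = ∑ y : (J → Fin p × Fin p) × (R → Fin p), ∏ j, w (y.1 j).1 (y.1 j).2 :=
      Fintype.sum_equiv E _ _ fun e => rfl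
    rw [h3, Fintype.sum_prod_type]
    simp only [Finset.sum_const, card_univ, nsmul_eq_mul, Fintype.card_pi, Fintype.card_fin,
      Finset.prod_const]
    rw [← mul_sum, ← Fintype.prod_sum (fun (_ : J) (a : Fin p × Fin p) => w a.1 a.2)]
    simp
  rw [← mul_sum, h2] at h1
  refine h1.trans ?_
  have hι : Fintype.card ι = Fintype.card J + Fintype.card J + Fintype.card R := by
    rw [← Fintype.card_congr σ, Fintype.card_sum, Fintype.card_sum]
  have h0 : 0 ≤ ∑ a : Fin p × Fin p, w a.1 a.2 :=
    Finset.sum_nonneg fun a _ => by simp only [w]; split_ifs <;> norm_num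
  calc _ ≤ 2 ^ l * ((p : ℝ) ^ Fintype.card R * (3 / 4 * (p : ℝ) ^ 2) ^ Fintype.card J) := by
        gcongr
        exact sum_lightWeight_le p
    _ = _ := by
        rw [hι, mul_pow, ← pow_mul, pow_add, pow_add]
        ring

end

section

open Finset

/-! ### Sparse functions and functions of small degree are few -/

theorem sum_flat_eq_sum_submodule {K ι : Type*} [Field K] [Fintype K] [Fintype ι] [DecidableEq ι]
    (g : (ι → K) → K) (W : Submodule K (ι → K)) [Fintype W]
    [DecidablePred fun x => x ∈ W] (x₀ : ι → K) :
    ∑ x with x - x₀ ∈ W, g x = ∑ w : W, g (x₀ + (w : ι → K)) := by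
  symm
  refine Finset.sum_bij (fun (w : W) _ => x₀ + (w : ι → K)) ?_ ?_ ?_ ?_
  · intro w _
    simp
  · intro w _ w' _ h
    exact Subtype.ext (add_left_cancel h)
  · intro x hx
    exact ⟨⟨x - x₀, (mem_filter.1 hx).2⟩, mem_univ _, by simp⟩
  · intro w _
    rfl

/-- If the restrictions of `f` to all `l`-dimensional flats fail to have full sparsity, then the
number of `-1`s on each of these flats is divisible by `p`. -/
theorem sumsToZeroOnFlats_of_sparsity_ne {p n l : ℕ} [hp : Fact p.Prime] (hl : 2 ≤ l)
    (f : BoolFn p n)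
    (h : ∀ (W : Submodule (ZMod p) (Fin n → ZMod p)) [Fintype W] (x₀ : Fin n → ZMod p),
      Module.finrank (ZMod p) W = l →
        sparsity (fun w : W => f (x₀ + (w : Fin n → ZMod p))) ≠ p ^ l) :
    SumsToZeroOnFlats l fun x => signBit (ZMod p) (f x) := by
  classical
  intro W hW x₀
  by_contra hne
  refine h W x₀ hW ?_
  have hcard : Fintype.card W = p ^ l := by
    rw [Module.card_eq_pow_finrank (K := ZMod p), ZMod.card, hW]
  refine sparsity_eq_card (fun x => ?_) hl hcard _ ?_
  · rw [← Nat.cast_smul_eq_nsmul (ZMod p), CharP.cast_eq_zero, zero_smul]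
  · rwa [← sum_flat_eq_sum_submodule (fun x => signBit (ZMod p) (f x))]

theorem sumsToZeroOnFlats_of_degP_lt {p n l : ℕ} [hp : Fact p.Prime] (hl : 2 ≤ l)
    (f : BoolFn p n) (hf : degP f < l) :
    SumsToZeroOnFlats l fun x => signBit (ZMod p) (f x) := by
  classical
  refine sumsToZeroOnFlats_of_sparsity_ne hl f fun W _ x₀ hW hs => hf.not_ge ?_
  refine le_csSup ⟨n, ?_⟩ ⟨W, x₀, hW, by convert hs⟩
  rintro k ⟨W', -, rfl, -⟩
  simpa using Submodule.finrank_le W'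

theorem sumsToZeroOnFlats_of_sparsity_lt {p n l : ℕ} [hp : Fact p.Prime] (hl : 2 ≤ l)
    (f : BoolFn p n) (hf : sparsity f < p ^ l) :
    SumsToZeroOnFlats l fun x => signBit (ZMod p) (f x) :=
  sumsToZeroOnFlats_of_sparsity_ne hl f fun W _ x₀ _ hs =>
    (hs ▸ sparsity_restrict_le W.subtype.toAddMonoidHom x₀ f).not_gt hf

theorem card_signFns_le_exp {p n : ℕ} [Fact p.Prime] (l : ℕ) (F : Finset (BoolFn p n))
    (hF : ∀ f ∈ F, SumsToZeroOnFlats l fun x => signBit (ZMod p) (f x)) :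
    (F.card : ℝ) ≤ Real.exp (2 ^ l * (3 / 4) ^ (n / 2) * (p : ℝ) ^ n) := by
  let σ : (Fin (n / 2) ⊕ Fin (n / 2)) ⊕ Fin (n % 2) ≃ Fin n :=
    Fintype.equivOfCardEq (by simp only [Fintype.card_sum, Fintype.card_fin]; omega)
  have h1 := card_signFns_sumsToZeroOnFlats_le σ l F hF
  have h2 := card_few_lightPairs_le (p := p) σ l
  simp only [Fintype.card_fin] at h2
  refine le_trans ?_ (Real.exp_le_exp.2 h2)
  set M := Fintype.card {e : Fin n → Fin p // (lightPairs σ e).card < l}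
  calc (F.card : ℝ) ≤ (2 : ℝ) ^ M := by exact_mod_cast h1
    _ ≤ Real.exp 1 ^ M := by
        gcongr
        have := Real.add_one_le_exp (1 : ℝ)
        linarith
    _ = Real.exp M := by rw [← Real.exp_nat_mul, mul_one]

/-! ### Most functions are far from every small class -/

/-- Chernoff bound for the correlation of a random sign function with a fixed one. -/
theorem card_sqDist_lt_le {p n : ℕ} [NeZero p] (g : BoolFn p n) {τ : ℝ} (hτ : 0 ≤ τ) :
    ((univ.filter fun f : BoolFn p n => sqDist f g < 2 - τ).card : ℝ)
      ≤ 2 ^ (p ^ n) * Real.exp (-(τ ^ 2 / 8) * (p : ℝ) ^ n) := by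
  set N : ℝ := (p : ℝ) ^ n with hN
  have hN0 : 0 < N := by
    have := NeZero.pos p
    positivity
  have hcard : (Fintype.card (Fin n → ZMod p) : ℝ) = N := by simp [hN, ZMod.card]
  let r : ℤˣ → ℝ := fun u => ((u : ℤ) : ℝ)
  have hr : ∀ u v, (r u - r v) ^ 2 = 2 - 2 * (r u * r v) := by
    intro u v
    rcases Int.units_eq_one_or u with rfl | rfl <;>
      rcases Int.units_eq_one_or v with rfl | rfl <;> norm_num [r]
  have hdist : ∀ f : BoolFn p n, sqDist f g = 2 - 2 / N * ∑ x, r (f x) * r (g x) := by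
    intro f
    have : sqDist f g = 1 / N * ∑ x, (r (f x) - r (g x)) ^ 2 := by rw [sqDist, hcard]
    rw [this]
    simp_rw [hr, Finset.sum_sub_distrib, ← mul_sum]
    rw [Finset.sum_const, card_univ, nsmul_eq_mul, hcard]
    field_simp
  -- The exponent `τ / 2` minimises the resulting bound.
  have h1 : ((univ.filter fun f : BoolFn p n => sqDist f g < 2 - τ).card : ℝ)
      ≤ ∑ f : BoolFn p n, Real.exp (-(τ ^ 2 / 4) * N) *
          ∏ x, Real.exp (τ / 2 * (r (f x) * r (g x))) := by
    rw [card_filter]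
    push_cast
    refine Finset.sum_le_sum fun f _ => ?_
    rw [← Real.exp_sum, ← Real.exp_add, ← mul_sum]
    split_ifs with h
    · rw [hdist] at h
      have h2 : τ / 2 * N < ∑ x, r (f x) * r (g x) := by
        have h3 : τ < 2 / N * ∑ x, r (f x) * r (g x) := by linarith
        rw [div_mul_eq_mul_div, lt_div_iff₀ hN0] at h3
        linarith
      apply Real.one_le_exp
      nlinarith
    · positivity
  refine h1.trans ?_
  rw [← mul_sum, ← Fintype.prod_sum (fun x (u : ℤˣ) => Real.exp (τ / 2 * (r u * r (g x))))]
  have h2 : ∀ x, ∑ u : ℤˣ, Real.exp (τ / 2 * (r u * r (g x))) = 2 * Real.cosh (τ / 2) := by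
    intro x
    have h3 : (univ : Finset ℤˣ) = {1, -1} := by decide
    rw [h3, Finset.sum_pair (by decide), Real.cosh_eq]
    rcases Int.units_eq_one_or (g x) with h | h
    · norm_num [r, h]
      ring
    · norm_num [r, h]
      ring
  rw [Finset.prod_congr rfl fun x _ => h2 x, Finset.prod_const, card_univ]
  have hcardN : Fintype.card (Fin n → ZMod p) = p ^ n := by simp [ZMod.card]
  rw [hcardN, mul_pow]
  have h4 : Real.cosh (τ / 2) ^ (p ^ n) ≤ Real.exp (τ ^ 2 / 8 * N) := by
    calc Real.cosh (τ / 2) ^ (p ^ n) ≤ Real.exp ((τ / 2) ^ 2 / 2) ^ (p ^ n) := by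
          gcongr
          exact Real.cosh_le_exp_half_sq _
      _ = _ := by
          rw [← Real.exp_nat_mul]
          push_cast
          congr 1
          ring
  calc _ ≤ Real.exp (-(τ ^ 2 / 4) * N) * (2 ^ (p ^ n) * Real.exp (τ ^ 2 / 8 * N)) := by gcongr
    _ = 2 ^ (p ^ n) * (Real.exp (-(τ ^ 2 / 4) * N) * Real.exp (τ ^ 2 / 8 * N)) := by ring
    _ = _ := by
      rw [← Real.exp_add]
      congr 2
      ring

/-- The proportion of monomials with few light pairs is arbitrarily small once `n` exceeds a
constant multiple of `t + 1`. -/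
theorem exists_forall_two_pow_mul_le {δ : ℝ} (hδ : 0 < δ) (B : ℕ) :
    ∃ K : ℕ, 0 < K ∧ ∀ t n : ℕ, K * (t + 1) ≤ n →
      B ≤ n ∧ (2 : ℝ) ^ (t + 2) * (3 / 4) ^ (n / 2) ≤ δ := by
  obtain ⟨k, hk⟩ := exists_pow_lt_of_lt_one (show 0 < min (δ / 4) (1 / 2) by positivity)
    (show (3 / 4 : ℝ) < 1 by norm_num)
  refine ⟨2 * k + B + 1, by omega, fun t n hn => ⟨by nlinarith, ?_⟩⟩
  have h1 : k * (t + 1) ≤ n / 2 := by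
    rw [Nat.le_div_iff_mul_le two_pos]
    nlinarith
  have h2 : (3 / 4 : ℝ) ^ k ≤ 1 / 2 := hk.le.trans (min_le_right _ _)
  have h3 : (3 / 4 : ℝ) ^ k ≤ δ / 4 := hk.le.trans (min_le_left _ _)
  calc (2 : ℝ) ^ (t + 2) * (3 / 4) ^ (n / 2)
      ≤ (2 : ℝ) ^ (t + 2) * (3 / 4) ^ (k * (t + 1)) := by
        gcongr 2 ^ (t + 2) * ?_
        exact pow_le_pow_of_le_one (by norm_num) (by norm_num) h1
    _ = 4 * (3 / 4) ^ k * (2 * (3 / 4) ^ k) ^ t := by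
        rw [pow_mul, pow_succ ((3 / 4 : ℝ) ^ k), mul_pow]
        ring
    _ ≤ 4 * (δ / 4) * 1 := by
        gcongr
        exact pow_le_one₀ (by positivity) (by linarith)
    _ = δ := by ring

open scoped Classical in
/-- Union bound over the class. The constant `112 = 7 * 16` makes the exponent
`τ ^ 2 p ^ n / 16` left over at least `7`, so that the near functions have proportion at most
`1 / (1 + 7)`. -/
theorem exists_forall_card_farFrom_ge {τ : ℝ} (hτ : 0 < τ) :
    ∃ K : ℕ, 0 < K ∧ ∀ (p : ℕ) [Fact p.Prime] (t n : ℕ), K * (t + 1) ≤ n →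
      ∀ P : Set (BoolFn p n),
        (∀ g ∈ P, SumsToZeroOnFlats (t + 2) fun x => signBit (ZMod p) (g x)) →
        7 * Fintype.card (BoolFn p n) ≤
          8 * (univ.filter fun f : BoolFn p n => FarFrom (2 - τ) P f).card := by
  obtain ⟨B, hB⟩ := exists_nat_ge (112 / τ ^ 2)
  obtain ⟨K, hK0, hK⟩ := exists_forall_two_pow_mul_le (show 0 < τ ^ 2 / 16 by positivity) B
  refine ⟨K, hK0, fun p hp t n hn P hP => ?_⟩
  obtain ⟨hBn, h1⟩ := hK t n hn
  set N : ℝ := (p : ℝ) ^ n with hN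
  have hBN : 112 / τ ^ 2 ≤ N := by
    have h2 : B ≤ p ^ n := hBn.trans (Nat.lt_pow_self hp.out.one_lt).le
    exact hB.trans (by rw [hN]; exact_mod_cast h2)
  have hnear : ((univ.filter fun f : BoolFn p n => ¬ FarFrom (2 - τ) P f).card : ℝ)
      ≤ 2 ^ (p ^ n) * (1 / 8) := by
    have h2 : (univ.filter fun f : BoolFn p n => ¬ FarFrom (2 - τ) P f) ⊆
        (univ.filter fun g => g ∈ P).biUnion fun g =>
          univ.filter fun f : BoolFn p n => sqDist f g < 2 - τ := by
      intro f hf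
      simp only [FarFrom, mem_filter, mem_univ, true_and, not_forall, not_le] at hf
      obtain ⟨g, hg, hfg⟩ := hf
      simp only [mem_biUnion, mem_filter, mem_univ, true_and]
      exact ⟨g, hg, hfg⟩
    have h3 := card_signFns_le_exp (t + 2) (univ.filter fun g => g ∈ P)
      fun f hf => hP f (mem_filter.1 hf).2
    rw [← hN] at h3
    calc ((univ.filter fun f : BoolFn p n => ¬ FarFrom (2 - τ) P f).card : ℝ)
        ≤ (((univ.filter fun g => g ∈ P).biUnion fun g =>
          univ.filter fun f : BoolFn p n => sqDist f g < 2 - τ).card : ℝ) := by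
          exact_mod_cast card_le_card h2
      _ ≤ ∑ g ∈ univ.filter fun g => g ∈ P,
            ((univ.filter fun f : BoolFn p n => sqDist f g < 2 - τ).card : ℝ) := by
          exact_mod_cast card_biUnion_le
      _ ≤ ∑ _g ∈ univ.filter fun g : BoolFn p n => g ∈ P,
            2 ^ (p ^ n) * Real.exp (-(τ ^ 2 / 8) * N) :=
          Finset.sum_le_sum fun g _ => card_sqDist_lt_le g hτ.le
      _ ≤ Real.exp (τ ^ 2 / 16 * N) * (2 ^ (p ^ n) * Real.exp (-(τ ^ 2 / 8) * N)) := by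
          rw [Finset.sum_const, nsmul_eq_mul]
          gcongr
          refine h3.trans (Real.exp_le_exp.2 ?_)
          gcongr
      _ = 2 ^ (p ^ n) * Real.exp (-(τ ^ 2 / 16 * N)) := by
          rw [mul_left_comm, ← Real.exp_add]
          congr 2
          ring
      _ ≤ 2 ^ (p ^ n) * (1 / 8) := by
          gcongr
          have h4 : 7 ≤ τ ^ 2 / 16 * N := by
            rw [div_le_iff₀ (by positivity)] at hBN
            linarith
          have h5 := Real.add_one_le_exp (τ ^ 2 / 16 * N)
          rw [Real.exp_neg, one_div]
          gcongr
          linarith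
  have htot : Fintype.card (BoolFn p n) = 2 ^ (p ^ n) := by simp [BoolFn, ZMod.card]
  have hsum := card_filter_add_card_filter_not (s := (univ : Finset (BoolFn p n)))
    (fun f => FarFrom (2 - τ) P f)
  rw [card_univ] at hsum
  have hsum' : ((univ.filter fun f : BoolFn p n => FarFrom (2 - τ) P f).card : ℝ) +
      ((univ.filter fun f : BoolFn p n => ¬ FarFrom (2 - τ) P f).card : ℝ)
        = Fintype.card (BoolFn p n) := by exact_mod_cast hsum
  have htot' : (Fintype.card (BoolFn p n) : ℝ) = 2 ^ (p ^ n) := by exact_mod_cast htot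
  have : (7 * Fintype.card (BoolFn p n) : ℝ)
      ≤ 8 * (univ.filter fun f : BoolFn p n => FarFrom (2 - τ) P f).card := by
    linarith
  exact_mod_cast this

/-! ### Random subspaces and random coset-constant functions -/

theorem mem_subspacesOfDim {p n d : ℕ} [Fact p.Prime]
    {H : Submodule (ZMod p) (Fin n → ZMod p)} :
    H ∈ subspacesOfDim p n d ↔ Module.finrank (ZMod p) H = d := by
  simp [subspacesOfDim]

theorem mem_cosetConstant {p n : ℕ} [Fact p.Prime]
    {H : Submodule (ZMod p) (Fin n → ZMod p)} {f : BoolFn p n} :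
    f ∈ cosetConstant H ↔ ∀ x y, x - y ∈ H → f x = f y := by
  simp [cosetConstant]

theorem exists_linearEquiv_apply_eq {K V : Type*} [Field K] [AddCommGroup V] [Module K V]
    [FiniteDimensional K V] {v w : V} (hv : v ≠ 0) (hw : w ≠ 0) : ∃ e : V ≃ₗ[K] V, e v = w := by
  let φ := (LinearEquiv.toSpanNonzeroSingleton K V v hv).symm ≪≫ₗ
    LinearEquiv.toSpanNonzeroSingleton K V w hw
  obtain ⟨g, hg⟩ := Submodule.exists_linearEquiv_restrict_eq φ
  refine ⟨g, ?_⟩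
  have h1 : (LinearEquiv.toSpanNonzeroSingleton K V v hv).symm
      ⟨v, Submodule.mem_span_singleton_self v⟩ = 1 := by
    rw [LinearEquiv.symm_apply_eq]
    ext
    simp
  have h2 := hg ⟨v, Submodule.mem_span_singleton_self v⟩
  simpa [φ, h1] using h2.symm

open scoped Classical in
/-- A fixed nonzero vector lies in a random `d`-dimensional subspace with probability
`(p ^ d - 1) / (p ^ n - 1)`, as the linear group is transitive on nonzero vectors. -/
theorem pow_mul_card_subspaces_mem_le {p n d t : ℕ} [hp : Fact p.Prime] (hdt : d + t ≤ n)
    {v : Fin n → ZMod p} (hv : v ≠ 0) :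
    p ^ t * ((subspacesOfDim p n d).filter fun H => v ∈ H).card
      ≤ (subspacesOfDim p n d).card := by
  set 𝓗 := subspacesOfDim p n d with h𝓗
  set N := (𝓗.filter fun H => v ∈ H).card with hN
  have htrans : ∀ w : Fin n → ZMod p, w ≠ 0 → (𝓗.filter fun H => w ∈ H).card = N := by
    intro w hw
    obtain ⟨e, he⟩ := exists_linearEquiv_apply_eq (K := ZMod p) hw hv
    have he' : e.symm v = w := by rw [← he, e.symm_apply_apply]
    refine Finset.card_bij' (fun H _ => H.map (e : (Fin n → ZMod p) →ₗ[ZMod p] _))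
      (fun H _ => H.map (e.symm : (Fin n → ZMod p) →ₗ[ZMod p] _)) ?_ ?_ ?_ ?_
    · intro H hH
      rw [mem_filter, mem_subspacesOfDim] at hH ⊢
      exact ⟨(e.finrank_map_eq H).trans hH.1, ⟨w, hH.2, he⟩⟩
    · intro H hH
      rw [mem_filter, mem_subspacesOfDim] at hH ⊢
      exact ⟨(e.symm.finrank_map_eq H).trans hH.1, ⟨v, hH.2, he'⟩⟩
    · intro H _
      ext x
      simp
    · intro H _
      ext x
      simp
  have hcount : ∀ H ∈ 𝓗, (univ.filter fun w => w ≠ 0 ∧ w ∈ H).card = p ^ d - 1 := by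
    intro H hH
    have h1 : (univ.filter fun w => w ∈ H).card = p ^ d := by
      rw [← Fintype.card_subtype, ← mem_subspacesOfDim.1 hH]
      exact (Module.card_eq_pow_finrank (K := ZMod p) (V := H)).trans (by rw [ZMod.card])
    have h2 : (univ.filter fun w => w ≠ 0 ∧ w ∈ H) = (univ.filter fun w => w ∈ H).erase 0 := by
      ext w
      simp
    rw [h2, card_erase_of_mem (by simp), h1]
  have hdouble : (p ^ n - 1) * N = 𝓗.card * (p ^ d - 1) := by
    have h1 := Finset.sum_card_bipartiteAbove_eq_sum_card_bipartiteBelow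
      (s := univ.filter fun w : Fin n → ZMod p => w ≠ 0) (t := 𝓗) (fun w H => w ∈ H)
    have h2 : (univ.filter fun w : Fin n → ZMod p => w ≠ 0).card = p ^ n - 1 := by
      rw [filter_ne', card_erase_of_mem (mem_univ _)]
      simp [ZMod.card]
    simp only [bipartiteAbove, bipartiteBelow, filter_filter] at h1
    rwa [Finset.sum_congr rfl fun w hw => htrans w (mem_filter.1 hw).2,
      Finset.sum_congr rfl hcount, Finset.sum_const, Finset.sum_const, h2, smul_eq_mul,
      smul_eq_mul] at h1
  have hn : 1 < p ^ n := by
    refine Nat.one_lt_pow ?_ hp.out.one_lt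
    rintro rfl
    exact hv (Subsingleton.elim _ _)
  have hpt : p ^ t * (p ^ d - 1) ≤ p ^ n - 1 := by
    have h1 : p ^ t * p ^ d ≤ p ^ n := by
      rw [← pow_add]
      exact Nat.pow_le_pow_right hp.out.pos (by omega)
    have h2 : 1 ≤ p ^ t := Nat.one_le_pow _ _ hp.out.pos
    rw [Nat.mul_sub, mul_one]
    omega
  refine Nat.le_of_mul_le_mul_left ?_ (show 0 < p ^ n - 1 by omega)
  calc (p ^ n - 1) * (p ^ t * N) = p ^ t * ((p ^ n - 1) * N) := by ring
    _ = 𝓗.card * (p ^ t * (p ^ d - 1)) := by rw [hdouble]; ring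
    _ ≤ 𝓗.card * (p ^ n - 1) := Nat.mul_le_mul_left _ hpt
    _ = _ := mul_comm _ _

open scoped Classical in
/-- Union bound over pairs: few subspaces identify two points of `Q`. -/
theorem pow_mul_card_subspaces_not_injOn_le {p n d t : ℕ} [hp : Fact p.Prime] (hdt : d + t ≤ n)
    (Q : Finset (Fin n → ZMod p)) :
    p ^ t * ((subspacesOfDim p n d).filter fun H => ¬ Set.InjOn H.mkQ Q).card
      ≤ Q.card ^ 2 * (subspacesOfDim p n d).card := by
  have h1 : ((subspacesOfDim p n d).filter fun H => ¬ Set.InjOn H.mkQ Q) ⊆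
      Q.offDiag.biUnion fun xy => (subspacesOfDim p n d).filter fun H => xy.1 - xy.2 ∈ H := by
    intro H hH
    simp only [mem_filter, Set.InjOn, not_forall] at hH
    obtain ⟨hH, x, hx, y, hy, hxy, hne⟩ := hH
    simp only [mem_biUnion, mem_offDiag, mem_filter]
    refine ⟨(x, y), ⟨hx, hy, hne⟩, hH, ?_⟩
    rwa [Submodule.mkQ_apply, Submodule.mkQ_apply, Submodule.Quotient.eq] at hxy
  calc p ^ t * ((subspacesOfDim p n d).filter fun H => ¬ Set.InjOn H.mkQ Q).card
      ≤ p ^ t * ∑ xy ∈ Q.offDiag,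
          ((subspacesOfDim p n d).filter fun H => xy.1 - xy.2 ∈ H).card :=
        Nat.mul_le_mul_left _ ((card_le_card h1).trans card_biUnion_le)
    _ ≤ ∑ _xy ∈ Q.offDiag, (subspacesOfDim p n d).card := by
        rw [mul_sum]
        exact Finset.sum_le_sum fun xy hxy =>
          pow_mul_card_subspaces_mem_le hdt (sub_ne_zero.2 (mem_offDiag.1 hxy).2.2)
    _ ≤ _ := by
        rw [Finset.sum_const, smul_eq_mul, offDiag_card, sq]
        exact Nat.mul_le_mul_right _ (Nat.sub_le _ _)

theorem two_pow_mul_card_agree {Y : Type*} [Fintype Y] [DecidableEq Y] (Q : Finset Y)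
    (g₀ : Y → ℤˣ) :
    2 ^ Q.card * (univ.filter fun g : Y → ℤˣ => ∀ y ∈ Q, g y = g₀ y).card
      = Fintype.card (Y → ℤˣ) := by
  have h1 : (univ.filter fun g : Y → ℤˣ => ∀ y ∈ Q, g y = g₀ y)
      = Fintype.piFinset fun y => if y ∈ Q then {g₀ y} else univ := by
    ext g
    simp only [mem_filter, mem_univ, true_and, Fintype.mem_piFinset]
    refine forall_congr' fun y => ?_
    split_ifs with h
    · simp [h]
    · simp only [h, mem_univ, false_imp_iff]
  have h2 : ∀ y, (if y ∈ Q then ({g₀ y} : Finset ℤˣ) else univ).card = if y ∈ Q then 1 else 2 := by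
    intro y
    split_ifs <;> simp
  rw [h1, Fintype.card_piFinset, Finset.prod_congr rfl fun y _ => h2 y, Finset.prod_ite]
  simp only [prod_const_one, one_mul, prod_const, Fintype.card_pi, Fintype.card_units_int]
  rw [← pow_add, card_univ, ← card_univ,
    ← card_filter_add_card_filter_not (s := (univ : Finset Y)) (fun y => y ∈ Q)]
  simp

open scoped Classical in
/-- On points in distinct cosets of `H`, a random coset-constant function is uniform. -/
theorem two_pow_mul_card_cosetConstant_agree {p n : ℕ} [Fact p.Prime]
    (H : Submodule (ZMod p) (Fin n → ZMod p)) (Q : Finset (Fin n → ZMod p))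
    (hQ : Set.InjOn H.mkQ Q) (f₀ : BoolFn p n) :
    2 ^ Q.card * ((cosetConstant H).filter fun f => ∀ x ∈ Q, f x = f₀ x).card
      = (cosetConstant H).card := by
  have : Fintype ((Fin n → ZMod p) ⧸ H) := Fintype.ofFinite _
  let g₀ : (Fin n → ZMod p) ⧸ H → ℤˣ := fun y => f₀ (Function.invFunOn H.mkQ Q y)
  have hg₀ : ∀ x ∈ Q, g₀ (H.mkQ x) = f₀ x := fun x hx => by
    simp only [g₀]
    rw [hQ.leftInvOn_invFunOn hx]
  have hcomp : ∀ f ∈ cosetConstant H, ∀ y, f (Function.surjInv H.mkQ_surjective (H.mkQ y)) = f y :=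
    fun f hf y => mem_cosetConstant.1 hf _ _ (by
      rw [← Submodule.Quotient.eq]
      exact Function.surjInv_eq H.mkQ_surjective (H.mkQ y))
  have hback : ∀ g : (Fin n → ZMod p) ⧸ H → ℤˣ, g ∘ H.mkQ ∈ cosetConstant H := fun g =>
    mem_cosetConstant.2 fun x y hxy => congrArg g ((Submodule.Quotient.eq H).2 hxy)
  have hcard : (cosetConstant H).card = Fintype.card ((Fin n → ZMod p) ⧸ H → ℤˣ) := by
    rw [← card_univ]
    refine Finset.card_bij' (fun f _ => f ∘ Function.surjInv H.mkQ_surjective)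
      (fun g _ => g ∘ H.mkQ) (fun _ _ => mem_univ _) (fun g _ => hback g) ?_ ?_
    · intro f hf
      exact funext fun y => hcomp f hf y
    · intro g _
      funext y
      exact congrArg g (Function.surjInv_eq H.mkQ_surjective y)
  have hagree : ((cosetConstant H).filter fun f => ∀ x ∈ Q, f x = f₀ x).card
      = (univ.filter fun g : (Fin n → ZMod p) ⧸ H → ℤˣ =>
          ∀ y ∈ Q.image H.mkQ, g y = g₀ y).card := by
    refine Finset.card_bij' (fun f _ => f ∘ Function.surjInv H.mkQ_surjective)
      (fun g _ => g ∘ H.mkQ) ?_ ?_ ?_ ?_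
    · intro f hf
      simp only [mem_filter, mem_univ, true_and, mem_image] at hf ⊢
      rintro _ ⟨x, hx, rfl⟩
      rw [hg₀ x hx, ← hf.2 x hx]
      exact hcomp f hf.1 x
    · intro g hg
      simp only [mem_filter, mem_univ, true_and, mem_image] at hg ⊢
      exact ⟨hback g, fun x hx => (hg _ ⟨x, hx, rfl⟩).trans (hg₀ x hx)⟩
    · intro f hf
      exact funext fun y => hcomp f (mem_filter.1 hf).1 y
    · intro g _
      funext y
      exact congrArg g (Function.surjInv_eq H.mkQ_surjective y)
  rw [hagree, hcard, ← two_pow_mul_card_agree (Q.image H.mkQ) g₀, card_image_of_injOn hQ]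

/-! ### Events of a finite probability space -/

/-- The probability of the event `E`, as a real number. -/
noncomputable def PMF.realProb {Ω : Type*} (P : PMF Ω) (E : Set Ω) : ℝ :=
  (P.toOuterMeasure E).toReal

open scoped Classical in
theorem PMF.realProb_eq_sum {Ω : Type*} [Fintype Ω] (P : PMF Ω) (E : Set Ω) :
    P.realProb E = ∑ x with x ∈ E, (P x).toReal := by
  rw [PMF.realProb, PMF.toOuterMeasure_apply_fintype,
    ENNReal.toReal_sum fun x _ => ((Set.indicator_le_self E P x).trans_lt
      (P.apply_lt_top x)).ne, sum_filter]
  refine Finset.sum_congr rfl fun x _ => ?_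
  rw [Set.indicator_apply]
  split_ifs <;> rfl

theorem PMF.realProb_add_compl {Ω : Type*} [Fintype Ω] (P : PMF Ω) (E : Set Ω) :
    P.realProb E + P.realProb Eᶜ = 1 := by
  classical
  rw [P.realProb_eq_sum, P.realProb_eq_sum]
  simp only [Set.mem_compl_iff]
  have h1 : ∑ x, P x = 1 := by rw [← P.tsum_coe, tsum_fintype]
  rw [Finset.sum_filter_add_sum_filter_not, ← ENNReal.toReal_sum fun x _ => P.apply_ne_top x,
    h1, ENNReal.toReal_one]

open scoped Classical in
theorem PMF.realProb_uniformOfFinset {Ω : Type*} (s : Finset Ω) (hs : s.Nonempty) (E : Set Ω) :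
    (PMF.uniformOfFinset s hs).realProb E = ((s.filter fun x => x ∈ E).card : ℝ) / s.card := by
  rw [PMF.realProb, PMF.toOuterMeasure_uniformOfFinset_apply]
  simp

open scoped Classical in
theorem realProb_yesDist {p n d : ℕ} [Fact p.Prime] (hd : d ≤ n) (E : Set (BoolFn p n)) :
    (yesDist p n d hd).realProb E = (∑ H ∈ subspacesOfDim p n d,
      (((cosetConstant H).filter fun f => f ∈ E).card : ℝ) / (cosetConstant H).card)
        / (subspacesOfDim p n d).card := by
  have : Fintype (Submodule (ZMod p) (Fin n → ZMod p)) := Fintype.ofFinite _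
  rw [PMF.realProb, yesDist, PMF.toOuterMeasure_bind_apply, tsum_fintype,
    ENNReal.toReal_sum fun H _ => ENNReal.mul_ne_top (PMF.apply_ne_top _ _)
      (by
        rw [PMF.toOuterMeasure_uniformOfFinset_apply]
        exact ENNReal.div_ne_top (ENNReal.natCast_ne_top _)
          (by simpa using (cosetConstant_nonempty H).ne_empty)),
    Finset.sum_div, ← Finset.sum_filter_add_sum_filter_not univ (fun H => H ∈ subspacesOfDim p n d),
    Finset.sum_eq_zero (s := univ.filter fun H => ¬ H ∈ subspacesOfDim p n d), add_zero,
    filter_mem_eq_inter, univ_inter]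
  · refine Finset.sum_congr rfl fun H hH => ?_
    rw [ENNReal.toReal_mul, PMF.uniformOfFinset_apply_of_mem _ hH]
    change _ * (PMF.realProb _ E) = _
    rw [PMF.realProb_uniformOfFinset]
    simp
    ring
  · intro H hH
    rw [PMF.uniformOfFinset_apply_of_notMem _ (mem_filter.1 hH).2]
    simp

/-! ### Decision trees cannot tell the two distributions apart -/

namespace DecisionTree

variable {X : Type*}

/-- The set of points queried on input `f`. -/
def queried [DecidableEq X] : DecisionTree X → (X → ℤˣ) → Finset X
  | leaf _, _ => ∅
  | query x next, f => insert x (queried (next (f x)) f)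

theorem card_queried_le_depth [DecidableEq X] (T : DecisionTree X) (f : X → ℤˣ) :
    (T.queried f).card ≤ T.depth := by
  induction T with
  | leaf a => simp [queried]
  | query x next ih =>
    refine (card_insert_le _ _).trans (Nat.succ_le_succ ((ih (f x)).trans ?_))
    rcases Int.units_eq_one_or (f x) with h | h <;> rw [h]
    · exact le_max_left _ _
    · exact le_max_right _ _

/-- The inputs reaching the same leaf as `f₀` are those that agree with it on the queried points. -/
theorem reachedLeaf_eq_iff [DecidableEq X] (T : DecisionTree X) (f f₀ : X → ℤˣ) :
    T.reachedLeaf f = T.reachedLeaf f₀ ↔ ∀ x ∈ T.queried f₀, f x = f₀ x := by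
  induction T with
  | leaf a => simp [queried, reachedLeaf]
  | query x next ih =>
    simp only [reachedLeaf, queried, List.cons.injEq, mem_insert, forall_eq_or_imp]
    refine and_congr_right fun h => ?_
    rw [h]
    exact ih _

theorem eval_eq_of_reachedLeaf_eq (T : DecisionTree X) (f f₀ : X → ℤˣ)
    (h : T.reachedLeaf f = T.reachedLeaf f₀) : T.eval f = T.eval f₀ := by
  induction T with
  | leaf a => rfl
  | query x next ih =>
    simp only [reachedLeaf, List.cons.injEq] at h
    simp only [eval]
    obtain ⟨h1, h2⟩ := h
    rw [h1] at h2 ⊢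
    exact ih _ h2

end DecisionTree

/-- Events determined by a finite-valued function have a lower bound for their probability as soon
as the fibres have one. -/
theorem PMF.mul_card_le_realProb_preimage {Ω Λ : Type*} [Fintype Ω] [DecidableEq Λ] (P : PMF Ω)
    (ℓ : Ω → Λ) (c : ℝ) (h : ∀ f₀, c * ((univ.filter fun f => ℓ f = ℓ f₀).card : ℝ)
      ≤ P.realProb {f | ℓ f = ℓ f₀}) (S : Set Λ)
    [DecidablePred fun f => f ∈ ℓ ⁻¹' S] :
    c * ((univ.filter fun f => f ∈ ℓ ⁻¹' S).card : ℝ) ≤ P.realProb (ℓ ⁻¹' S) := by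
  classical
  have hmap : ∀ f ∈ univ.filter (fun f => f ∈ ℓ ⁻¹' S), ℓ f ∈ (univ.image ℓ).filter (· ∈ S) :=
    fun f hf => mem_filter.2 ⟨mem_image_of_mem _ (mem_univ _), (mem_filter.1 hf).2⟩
  have hfib : ∀ f₀, ℓ f₀ ∈ S → (univ.filter fun f => f ∈ ℓ ⁻¹' S).filter (fun f => ℓ f = ℓ f₀)
      = univ.filter fun f => ℓ f = ℓ f₀ := by
    intro f₀ hf₀
    ext f
    simp only [mem_filter, mem_univ, true_and, Set.mem_preimage, and_iff_right_iff_imp]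
    intro h1
    rwa [h1]
  have hsum : P.realProb (ℓ ⁻¹' S)
      = ∑ f ∈ univ.filter (fun f => f ∈ ℓ ⁻¹' S), (P f).toReal := by
    rw [P.realProb_eq_sum]
    congr!
  rw [hsum, card_eq_sum_card_fiberwise hmap, ← Finset.sum_fiberwise_of_maps_to hmap]
  push_cast
  rw [mul_sum]
  refine Finset.sum_le_sum fun a ha => ?_
  obtain ⟨ha, haS⟩ := mem_filter.1 ha
  obtain ⟨f₀, -, rfl⟩ := mem_image.1 ha
  rw [hfib f₀ haS]
  refine (h f₀).trans_eq ?_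
  rw [P.realProb_eq_sum]
  congr!

/-- Each leaf is reached by a random coset-constant function with at least `1 - q ^ 2 / p ^ t`
times its probability under the uniform distribution: with probability at least
`1 - q ^ 2 / p ^ t` the queried points on the way to the leaf lie in distinct cosets. -/
theorem le_realProb_yesDist_reachedLeaf {p n d t : ℕ} [hp : Fact p.Prime] (hdt : d + t ≤ n)
    (hd : d ≤ n) (T : DecisionTree (Fin n → ZMod p)) (S : Set (List ℤˣ))
    [DecidablePred fun f : BoolFn p n => f ∈ T.reachedLeaf ⁻¹' S] :
    (1 - (T.depth : ℝ) ^ 2 / (p : ℝ) ^ t) *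
      (((univ.filter fun f : BoolFn p n => f ∈ T.reachedLeaf ⁻¹' S).card : ℝ) /
        Fintype.card (BoolFn p n)) ≤ (yesDist p n d hd).realProb (T.reachedLeaf ⁻¹' S) := by
  classical
  rw [mul_div_left_comm, mul_comm]
  convert PMF.mul_card_le_realProb_preimage (yesDist p n d hd) T.reachedLeaf
    ((1 - (T.depth : ℝ) ^ 2 / (p : ℝ) ^ t) / Fintype.card (BoolFn p n)) ?_ S
  intro f₀
  set Q := T.queried f₀
  have hpt : (0 : ℝ) < (p : ℝ) ^ t := by
    have := hp.out.pos
    positivity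
  have hset : {f | T.reachedLeaf f = T.reachedLeaf f₀} = {f | ∀ x ∈ Q, f x = f₀ x} :=
    Set.ext fun f => T.reachedLeaf_eq_iff f f₀
  have hfilter : (univ.filter fun f => T.reachedLeaf f = T.reachedLeaf f₀)
      = univ.filter fun f : BoolFn p n => ∀ x ∈ Q, f x = f₀ x :=
    Finset.filter_congr fun f _ => T.reachedLeaf_eq_iff f f₀
  have hU : ((univ.filter fun f : BoolFn p n => ∀ x ∈ Q, f x = f₀ x).card : ℝ)
      / Fintype.card (BoolFn p n) = 1 / 2 ^ Q.card := by
    have h1 : ((2 : ℝ) ^ Q.card) * (univ.filter fun f : BoolFn p n => ∀ x ∈ Q, f x = f₀ x).card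
        = Fintype.card (BoolFn p n) := by exact_mod_cast two_pow_mul_card_agree Q f₀
    have h2 : (Fintype.card (BoolFn p n) : ℝ) ≠ 0 := by exact_mod_cast Fintype.card_ne_zero
    rw [div_eq_div_iff h2 (by positivity)]
    linarith
  set 𝓗 := subspacesOfDim p n d with h𝓗
  have h𝓗0 : (0 : ℝ) < 𝓗.card := by
    exact_mod_cast (subspacesOfDim_nonempty hd).card_pos
  have hgood : (1 - (T.depth : ℝ) ^ 2 / (p : ℝ) ^ t) * 𝓗.card
      ≤ (𝓗.filter fun H => Set.InjOn H.mkQ Q).card := by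
    have h1 : ((p : ℝ) ^ t) * (𝓗.filter fun H => ¬ Set.InjOn H.mkQ Q).card
        ≤ (Q.card : ℝ) ^ 2 * 𝓗.card := by
      exact_mod_cast pow_mul_card_subspaces_not_injOn_le hdt Q
    have h2 : ((𝓗.filter fun H => Set.InjOn H.mkQ Q).card : ℝ) +
        (𝓗.filter fun H => ¬ Set.InjOn H.mkQ Q).card = 𝓗.card := by
      exact_mod_cast card_filter_add_card_filter_not _
    have h3 : ((𝓗.filter fun H => ¬ Set.InjOn H.mkQ Q).card : ℝ)
        ≤ (T.depth : ℝ) ^ 2 / (p : ℝ) ^ t * 𝓗.card := by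
      rw [div_mul_eq_mul_div, le_div_iff₀ hpt, mul_comm]
      refine h1.trans ?_
      gcongr
      exact T.card_queried_le_depth f₀
    linarith
  have hterm : ∀ H ∈ 𝓗, (if Set.InjOn H.mkQ Q then (1 : ℝ) / 2 ^ Q.card else 0) ≤
      (((cosetConstant H).filter fun f => f ∈ {f | ∀ x ∈ Q, f x = f₀ x}).card : ℝ)
        / (cosetConstant H).card := by
    intro H _
    split_ifs with h
    · have h1 : ((2 : ℝ) ^ Q.card) *
          ((cosetConstant H).filter fun f => ∀ x ∈ Q, f x = f₀ x).card
            = (cosetConstant H).card := by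
        exact_mod_cast two_pow_mul_card_cosetConstant_agree H Q h f₀
      have h2 : (0 : ℝ) < (cosetConstant H).card := by
        exact_mod_cast (cosetConstant_nonempty H).card_pos
      rw [div_le_div_iff₀ (by positivity) h2]
      simp only [Set.mem_ofPred_eq]
      linarith
    · positivity
  rw [hset, hfilter, div_mul_eq_mul_div, mul_div_assoc, hU, realProb_yesDist,
    le_div_iff₀ h𝓗0]
  refine le_trans ?_ (Finset.sum_le_sum fun H hH => (hterm H hH).trans_eq (by congr!))
  rw [← Finset.sum_filter, Finset.sum_const, nsmul_eq_mul, mul_right_comm]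
  gcongr

theorem le_realProb_uniformOfFinset {Ω : Type*} [Fintype Ω] [DecidableEq Ω] (s : Finset Ω)
    (hs : s.Nonempty) (hcard : 7 * Fintype.card Ω ≤ 8 * s.card) (E : Set Ω)
    [DecidablePred fun x => x ∈ E] :
    ((univ.filter fun x => x ∈ E).card : ℝ) / Fintype.card Ω - 1 / 8
      ≤ (PMF.uniformOfFinset s hs).realProb E := by
  classical
  rw [PMF.realProb_uniformOfFinset]
  have hs0 : (0 : ℝ) < s.card := by exact_mod_cast hs.card_pos
  have hsΩ : (s.card : ℝ) ≤ Fintype.card Ω := by exact_mod_cast card_le_univ s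
  have hΩ : (0 : ℝ) < Fintype.card Ω := hs0.trans_le hsΩ
  have hcard' : 7 * (Fintype.card Ω : ℝ) ≤ 8 * s.card := by exact_mod_cast hcard
  have h1 : (univ.filter fun x => x ∈ E).card ≤ (s.filter fun x => x ∈ E).card + sᶜ.card := by
    refine (card_le_card (t := (s.filter fun x => x ∈ E) ∪ sᶜ) fun x hx => ?_).trans
      (card_union_le _ _)
    by_cases hxs : x ∈ s <;> simp_all
  have h2 : (sᶜ.card : ℝ) = Fintype.card Ω - s.card := by
    rw [card_compl, Nat.cast_sub (card_le_univ s)]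
  have h3 : ((univ.filter fun x => x ∈ E).card : ℝ)
      ≤ (s.filter fun x => x ∈ E).card + sᶜ.card := by exact_mod_cast h1
  have h4 : ((univ.filter fun x => x ∈ E).card : ℝ) / Fintype.card Ω - 1 / 8
      ≤ ((s.filter fun x => x ∈ E).card : ℝ) / Fintype.card Ω := by
    rw [sub_le_iff_le_add, div_add' _ _ _ hΩ.ne']
    gcongr
    linarith
  refine h4.trans ((div_le_div_of_nonneg_left (by positivity) hs0 hsΩ).trans_eq ?_)
  congr!

/-- Both distributions are close to the uniform one on the leaves of a shallow tree. -/
theorem abs_realProb_yesDist_sub_le {p n d t : ℕ} [hp : Fact p.Prime] (hdt : d + t ≤ n)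
    (hd : d ≤ n) (s : Finset (BoolFn p n)) (hs : s.Nonempty)
    (hcard : 7 * Fintype.card (BoolFn p n) ≤ 8 * s.card) (T : DecisionTree (Fin n → ZMod p))
    (hT : 9 * (T.depth : ℝ) ^ 2 ≤ (p : ℝ) ^ t) (S : Set (List ℤˣ)) :
    |(yesDist p n d hd).realProb (T.reachedLeaf ⁻¹' S)
      - (PMF.uniformOfFinset s hs).realProb (T.reachedLeaf ⁻¹' S)| ≤ 1 / 4 := by
  classical
  have hpt : (0 : ℝ) < (p : ℝ) ^ t := by
    have := hp.out.pos
    positivity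
  have hη : (T.depth : ℝ) ^ 2 / (p : ℝ) ^ t ≤ 1 / 9 := by
    rw [div_le_iff₀ hpt]
    linarith
  let u : Set (BoolFn p n) → ℝ := fun E =>
    ((univ.filter fun x => x ∈ E).card : ℝ) / Fintype.card (BoolFn p n)
  have hΩ : (0 : ℝ) < Fintype.card (BoolFn p n) := by exact_mod_cast Fintype.card_pos
  have hu0 : ∀ E, 0 ≤ u E := fun E => by positivity
  have hu : ∀ E, u E + u Eᶜ = 1 := by
    intro E
    have h1 := card_filter_add_card_filter_not (s := (univ : Finset (BoolFn p n))) (fun f => f ∈ E)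
    simp only [u, Set.mem_compl_iff]
    rw [← add_div, div_eq_one_iff_eq hΩ.ne']
    exact_mod_cast h1
  have hyes : ∀ S : Set (List ℤˣ), u (T.reachedLeaf ⁻¹' S) - 1 / 9
      ≤ (yesDist p n d hd).realProb (T.reachedLeaf ⁻¹' S) := by
    intro S
    have h1 := le_realProb_yesDist_reachedLeaf hdt hd T S
    have h2 : u (T.reachedLeaf ⁻¹' S) ≤ 1 := by
      linarith [hu (T.reachedLeaf ⁻¹' S), hu0 (T.reachedLeaf ⁻¹' S)ᶜ]
    have h3 := hu0 (T.reachedLeaf ⁻¹' S)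
    refine le_trans ?_ h1
    change _ ≤ _ * u (T.reachedLeaf ⁻¹' S)
    nlinarith
  have hno : ∀ S : Set (List ℤˣ), u (T.reachedLeaf ⁻¹' S) - 1 / 8
      ≤ (PMF.uniformOfFinset s hs).realProb (T.reachedLeaf ⁻¹' S) := fun S =>
    le_realProb_uniformOfFinset s hs hcard _
  have hyc := hyes Sᶜ
  have hnc := hno Sᶜ
  rw [Set.preimage_compl] at hyc hnc
  have h1 := (yesDist p n d hd).realProb_add_compl (T.reachedLeaf ⁻¹' S)
  have h2 := (PMF.uniformOfFinset s hs).realProb_add_compl (T.reachedLeaf ⁻¹' S)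
  have h3 := hu (T.reachedLeaf ⁻¹' S)
  rw [abs_le]
  constructor
  · linarith [hyes S]
  · linarith [hno S]

theorem tvDist_map_le {Ω Λ : Type*} (P Q : PMF Ω) (ℓ : Ω → Λ) {δ : ℝ}
    (h : ∀ S : Set Λ, |P.realProb (ℓ ⁻¹' S) - Q.realProb (ℓ ⁻¹' S)| ≤ δ) :
    tvDist (PMF.map ℓ P) (PMF.map ℓ Q) ≤ δ := by
  refine ciSup_le fun S => ?_
  rw [PMF.toOuterMeasure_map_apply, PMF.toOuterMeasure_map_apply]
  exact h S

/-- The acceptance probability as an average over the deterministic decision trees. -/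
theorem QueryAlgorithm.acceptProb_eq_toReal_tsum {X : Type*} (A : QueryAlgorithm X)
    (D : PMF (X → ℤˣ)) :
    A.acceptProb D = (∑' T, A T * D.toOuterMeasure {f | T.eval f = true}).toReal := by
  have h1 : (D.bind fun f => A.verdict f) = A.bind fun T => PMF.map (fun f => T.eval f) D := by
    simp_rw [QueryAlgorithm.verdict, ← PMF.bind_pure_comp]
    exact PMF.bind_comm D A fun f T => PMF.pure (T.eval f)
  rw [QueryAlgorithm.acceptProb, h1, PMF.bind_apply]
  congr 1
  refine tsum_congr fun T => ?_
  rw [← PMF.toOuterMeasure_apply_singleton (PMF.map _ D), PMF.toOuterMeasure_map_apply]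
  rfl

theorem QueryAlgorithm.acceptProb_sub_le {X : Type*} (A : QueryAlgorithm X)
    (D D' : PMF (X → ℤˣ)) {δ : ℝ} (hδ : 0 ≤ δ)
    (h : ∀ T ∈ A.support, D.realProb {f | T.eval f = true}
      ≤ D'.realProb {f | T.eval f = true} + δ) :
    A.acceptProb D - A.acceptProb D' ≤ δ := by
  have hle : ∀ (P : PMF (X → ℤˣ)) E, P.toOuterMeasure E ≤ 1 := fun P E =>
    (MeasureTheory.measure_mono (Set.subset_univ E)).trans_eq
      ((PMF.toOuterMeasure_apply_eq_one_iff P Set.univ).2 (Set.subset_univ _))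
  have hfin : ∀ P : PMF (X → ℤˣ), ∑' T, A T * P.toOuterMeasure {f | T.eval f = true} ≠ ⊤ := by
    intro P
    refine ne_top_of_le_ne_top ENNReal.one_ne_top ?_
    rw [← A.tsum_coe]
    exact ENNReal.tsum_le_tsum fun T => mul_le_of_le_one_right' (hle P _)
  rw [A.acceptProb_eq_toReal_tsum, A.acceptProb_eq_toReal_tsum, sub_le_iff_le_add']
  rw [← ENNReal.toReal_ofReal hδ, ← ENNReal.toReal_add (hfin D') ENNReal.ofReal_ne_top]
  refine ENNReal.toReal_mono (ENNReal.add_ne_top.2 ⟨hfin D', ENNReal.ofReal_ne_top⟩) ?_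
  have h1 : ENNReal.ofReal δ = ∑' T, A T * ENNReal.ofReal δ := by
    rw [ENNReal.tsum_mul_right, A.tsum_coe, one_mul]
  rw [h1, ← ENNReal.tsum_add]
  refine ENNReal.tsum_le_tsum fun T => ?_
  by_cases hT : A T = 0
  · simp [hT]
  rw [← mul_add]
  gcongr
  have hne : ∀ P : PMF (X → ℤˣ), P.toOuterMeasure {f | T.eval f = true} ≠ ⊤ := fun P =>
    ne_top_of_le_ne_top ENNReal.one_ne_top (hle P _)
  rw [← ENNReal.ofReal_toReal (hne D), ← ENNReal.ofReal_toReal (hne D'),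
    ← ENNReal.ofReal_add ENNReal.toReal_nonneg hδ]
  exact ENNReal.ofReal_le_ofReal (h T hT)

theorem abs_acceptProb_yesDist_sub_le {p n d t : ℕ} [hp : Fact p.Prime] (hdt : d + t ≤ n)
    (hd : d ≤ n) (s : Finset (BoolFn p n)) (hs : s.Nonempty)
    (hcard : 7 * Fintype.card (BoolFn p n) ≤ 8 * s.card)
    (A : QueryAlgorithm (Fin n → ZMod p)) (q : ℕ) (hA : A.MakesAtMost q)
    (hq : 9 * (q : ℝ) ^ 2 ≤ (p : ℝ) ^ t) :
    |A.acceptProb (yesDist p n d hd) - A.acceptProb (PMF.uniformOfFinset s hs)| ≤ 1 / 4 := by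
  have key : ∀ T ∈ A.support, |(yesDist p n d hd).realProb {f | T.eval f = true}
      - (PMF.uniformOfFinset s hs).realProb {f | T.eval f = true}| ≤ 1 / 4 := by
    intro T hT
    have hset : {f | T.eval f = true}
        = T.reachedLeaf ⁻¹' (T.reachedLeaf '' {f | T.eval f = true}) := by
      refine Set.Subset.antisymm (Set.subset_preimage_image _ _) ?_
      rintro f ⟨f', hf', hff⟩
      exact (T.eval_eq_of_reachedLeaf_eq f' f hff).symm.trans hf'
    rw [hset]
    refine abs_realProb_yesDist_sub_le hdt hd s hs hcard T (le_trans ?_ hq) _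
    gcongr
    exact hA T hT
  rw [abs_le]
  constructor
  · have := A.acceptProb_sub_le (PMF.uniformOfFinset s hs) (yesDist p n d hd)
      (show (0 : ℝ) ≤ 1 / 4 by norm_num) fun T hT => by linarith [(abs_le.1 (key T hT)).1]
    linarith
  · exact A.acceptProb_sub_le (yesDist p n d hd) (PMF.uniformOfFinset s hs)
      (show (0 : ℝ) ≤ 1 / 4 by norm_num) fun T hT => by linarith [(abs_le.1 (key T hT)).2]

/-! ### The query lower bounds -/

theorem QueryAlgorithm.acceptProb_ge {X : Type*} (A : QueryAlgorithm X) (D : PMF (X → ℤˣ))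
    {r : ℝ} (h : ∀ f ∈ D.support, r ≤ (A.verdict f true).toReal) : r ≤ A.acceptProb D := by
  rw [QueryAlgorithm.acceptProb, PMF.bind_apply]
  have hfin : ∑' f, D f * A.verdict f true ≠ ⊤ := by
    rw [← PMF.bind_apply]
    exact PMF.apply_ne_top _ _
  rw [← ENNReal.ofReal_le_iff_le_toReal hfin]
  calc ENNReal.ofReal r = ∑' f, D f * ENNReal.ofReal r := by
        rw [ENNReal.tsum_mul_right, D.tsum_coe, one_mul]
    _ ≤ _ := by
        refine ENNReal.tsum_le_tsum fun f => ?_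
        by_cases hf : D f = 0
        · simp [hf]
        gcongr
        exact (ENNReal.ofReal_le_iff_le_toReal (PMF.apply_ne_top _ _)).2 (h f hf)

theorem QueryAlgorithm.acceptProb_le {X : Type*} (A : QueryAlgorithm X) (D : PMF (X → ℤˣ))
    {r : ℝ} (hr : 0 ≤ r) (h : ∀ f ∈ D.support, (A.verdict f true).toReal ≤ r) :
    A.acceptProb D ≤ r := by
  rw [QueryAlgorithm.acceptProb, PMF.bind_apply]
  refine ENNReal.toReal_le_of_le_ofReal hr ?_
  calc ∑' f, D f * A.verdict f true ≤ ∑' f, D f * ENNReal.ofReal r := by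
        refine ENNReal.tsum_le_tsum fun f => ?_
        by_cases hf : D f = 0
        · simp [hf]
        gcongr
        exact (ENNReal.le_ofReal_iff_toReal_le (PMF.apply_ne_top _ _) hr).2 (h f hf)
    _ = ENNReal.ofReal r := by rw [ENNReal.tsum_mul_right, D.tsum_coe, one_mul]

theorem QueryAlgorithm.verdict_true_add_false {X : Type*} (A : QueryAlgorithm X) (f : X → ℤˣ) :
    (A.verdict f true).toReal + (A.verdict f false).toReal = 1 := by
  have h1 : A.verdict f true + A.verdict f false = 1 := by
    rw [← (A.verdict f).tsum_coe, tsum_fintype, Fintype.sum_bool]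
  rw [← ENNReal.toReal_add (PMF.apply_ne_top _ _) (PMF.apply_ne_top _ _), h1, ENNReal.toReal_one]

/-- A function constant on the cosets of a subspace of codimension `t` is `p ^ t`-sparse. -/
theorem sparsity_le_of_mem_support_yesDist {p n d t : ℕ} [hp : Fact p.Prime] (hdt : d + t = n)
    (hd : d ≤ n) (f : BoolFn p n) (hf : f ∈ (yesDist p n d hd).support) :
    sparsity f ≤ p ^ t := by
  rw [yesDist, PMF.mem_support_bind_iff] at hf
  obtain ⟨H, hH, hf⟩ := hf
  rw [PMF.mem_support_uniformOfFinset_iff] at hH hf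
  have h1 := sparsity_le_card_quotient H.toAddSubgroup f (mem_cosetConstant.1 hf)
  refine h1.trans_eq ?_
  change Nat.card ((Fin n → ZMod p) ⧸ H) = p ^ t
  have : Fintype ((Fin n → ZMod p) ⧸ H) := Fintype.ofFinite _
  rw [Nat.card_eq_fintype_card, Module.card_eq_pow_finrank (K := ZMod p), ZMod.card]
  congr 1
  have h2 := H.finrank_quotient_add_finrank
  rw [mem_subspacesOfDim.1 hH, Module.finrank_fintype_fun_eq_card, Fintype.card_fin] at h2
  omega

theorem nine_mul_sq_le_of_lt {p t : ℕ} {q : ℝ} (hq0 : 0 ≤ q)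
    (hq : q < 1 / 3 * (p : ℝ) ^ ((t : ℝ) / 2)) : 9 * q ^ 2 ≤ (p : ℝ) ^ t := by
  have h1 : ((p : ℝ) ^ ((t : ℝ) / 2)) ^ 2 = (p : ℝ) ^ t := by
    rw [← Real.rpow_natCast, ← Real.rpow_mul (Nat.cast_nonneg p)]
    push_cast
    rw [div_mul_cancel₀ _ (two_ne_zero), Real.rpow_natCast]
  rw [← h1]
  have h2 : 3 * q ≤ (p : ℝ) ^ ((t : ℝ) / 2) := by linarith
  calc 9 * q ^ 2 = (3 * q) ^ 2 := by ring
    _ ≤ _ := by gcongr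

/-- A tester with few queries would accept random coset-constant functions, which are sparse, and
random far functions with nearly the same probability. -/
theorem pow_lt_nine_mul_sq_of_isTester {p n s t : ℕ} [hp : Fact p.Prime] {ε : ℝ}
    (hts : p ^ t ≤ s) (htn : t ≤ n)
    (hfar : 7 * Fintype.card (BoolFn p n) ≤
      8 * (Set.toFinite {f : BoolFn p n | FarFrom ε (sparseFns p n s) f}).toFinset.card)
    (A : QueryAlgorithm (Fin n → ZMod p)) (q : ℕ) (hA : A.MakesAtMost q)
    (hT : IsTester A (sparseFns p n s) ε) : (p : ℝ) ^ t < 9 * (q : ℝ) ^ 2 := by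
  by_contra hcon
  rw [not_lt] at hcon
  set F := (Set.toFinite {f : BoolFn p n | FarFrom ε (sparseFns p n s) f}).toFinset
  have hF : F.Nonempty := by
    rw [← card_pos]
    have : 0 < Fintype.card (BoolFn p n) := Fintype.card_pos
    omega
  have hd : n - t ≤ n := Nat.sub_le _ _
  have h1 := abs_acceptProb_yesDist_sub_le (d := n - t) (t := t) (by omega) hd F hF hfar A q hA hcon
  have h2 : 2 / 3 ≤ A.acceptProb (yesDist p n (n - t) hd) :=
    A.acceptProb_ge _ fun f hf => hT.1 f
      ((sparsity_le_of_mem_support_yesDist (by omega) hd f hf).trans hts)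
  have h3 : A.acceptProb (PMF.uniformOfFinset F hF) ≤ 1 / 3 := by
    refine A.acceptProb_le _ (by norm_num) fun f hf => ?_
    rw [PMF.mem_support_uniformOfFinset_iff, Set.Finite.mem_toFinset] at hf
    linarith [hT.2 f hf, A.verdict_true_add_false f]
  linarith [(abs_le.1 h1).2]

theorem third_mul_sqrt_le_of_lt_nine_mul_sq {x : ℝ} {q : ℕ} (h : x < 9 * (q : ℝ) ^ 2) :
    1 / 3 * √x ≤ q := by
  have h1 : √x ≤ 3 * q := by
    rw [Real.sqrt_le_left (by positivity)]
    linarith [mul_pow (3 : ℝ) (q : ℝ) 2]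
  linarith

end

theorem mainTheorem6 :
    ∃ c : ℝ, 0 < c ∧
      -- the query lower bound for testing sparsity
      (∀ ε : ℝ, 0 < ε → ε < 2 → ∃ K : ℕ, ∀ (p : ℕ) [Fact p.Prime] (s n : ℕ),
        K * (Nat.log p s + 1) ≤ n →
        ∀ (A : QueryAlgorithm (Fin n → ZMod p)) (q : ℕ),
          A.MakesAtMost q → IsTester A (sparseFns p n s) ε →
            c * √((s : ℝ) / p) ≤ q ∧ ((∃ t : ℕ, s = p ^ t) → c * √(s : ℝ) ≤ q)) ∧
      -- the two distributions are indistinguishable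
      (∀ τ : ℝ, 0 < τ → ∃ C₀ : ℕ, ∀ C : ℕ, C₀ ≤ C →
        ∀ (p : ℕ) [Fact p.Prime] (t : ℕ), 1 ≤ t →
          ∃ hfar : (farFromDeg p (C * t) t (2 - τ)).Nonempty,
            ∀ (d : ℕ) (hd : d + t ≤ C * t),
              (∀ T : DecisionTree (Fin (C * t) → ZMod p),
                (T.depth : ℝ) < c * (p : ℝ) ^ ((t : ℝ) / 2) →
                tvDist
                  (PMF.map T.reachedLeaf
                    (yesDist p (C * t) d (le_trans (Nat.le_add_right d t) hd)))
                  (PMF.map T.reachedLeaf (noDist p (C * t) t (2 - τ) hfar)) ≤ 1 / 3) ∧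
              ∀ (A : QueryAlgorithm (Fin (C * t) → ZMod p)) (q : ℕ),
                A.MakesAtMost q →
                1 / 3 ≤ |A.acceptProb (yesDist p (C * t) d (le_trans (Nat.le_add_right d t) hd))
                  - A.acceptProb (noDist p (C * t) t (2 - τ) hfar)| →
                c * (p : ℝ) ^ ((t : ℝ) / 2) ≤ q) := by
  classical
  refine ⟨1 / 3, by norm_num, fun ε _ hε2 => ?_, fun τ hτ => ?_⟩
  · obtain ⟨K, hK0, hK⟩ := exists_forall_card_farFrom_ge (sub_pos.2 hε2)
    refine ⟨K, fun p hp s n hn A q hA hT => ?_⟩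
    rcases Nat.eq_zero_or_pos s with rfl | hs
    · refine ⟨by simp, ?_⟩
      rintro ⟨t, ht⟩
      exact absurd ht.symm (pow_ne_zero t hp.out.ne_zero)
    set t := Nat.log p s with ht
    have hts : p ^ t ≤ s := Nat.pow_log_le_self p hs.ne'
    have hst : s < p ^ (t + 1) := Nat.lt_pow_succ_log_self hp.out.one_lt s
    have hfar := hK p t n hn (sparseFns p n s) fun g hg =>
      sumsToZeroOnFlats_of_sparsity_lt (by omega) g (lt_of_le_of_lt hg
        (hst.trans_le (Nat.pow_le_pow_right hp.out.pos (by omega))))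
    rw [sub_sub_cancel] at hfar
    have hq := pow_lt_nine_mul_sq_of_isTester hts (by nlinarith) (ε := ε)
      (by convert hfar using 3; ext f; simp) A q hA hT
    constructor
    · refine le_trans ?_ (third_mul_sqrt_le_of_lt_nine_mul_sq hq)
      have hp0 : (0 : ℝ) < p := by exact_mod_cast hp.out.pos
      gcongr
      rw [div_le_iff₀ hp0, ← pow_succ]
      exact_mod_cast hst.le
    · rintro ⟨k, hk⟩
      have hkt : t = k := by rw [ht, hk, Nat.log_pow hp.out.one_lt]
      have hs' : (s : ℝ) = (p : ℝ) ^ t := by rw [hk, hkt]; push_cast; rfl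
      rw [hs']
      exact third_mul_sqrt_le_of_lt_nine_mul_sq hq
  · obtain ⟨K, hK0, hK⟩ := exists_forall_card_farFrom_ge hτ
    -- `C * t ≥ K * (t + 1)` because `t ≥ 1`.
    refine ⟨2 * K, fun C hC p hp t ht => ?_⟩
    have hfar := hK p t (C * t) (by nlinarith) {g | degP g = t} fun g hg =>
      sumsToZeroOnFlats_of_degP_lt (by omega) g (by rw [Set.mem_ofPred_eq] at hg; omega)
    replace hfar : 7 * Fintype.card (BoolFn p (C * t)) ≤
        8 * (farFromDeg p (C * t) t (2 - τ)).card := by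
      convert hfar using 3
      ext f
      simp [farFromDeg]
    have hne : (farFromDeg p (C * t) t (2 - τ)).Nonempty := by
      rw [← Finset.card_pos]
      have : 0 < Fintype.card (BoolFn p (C * t)) := Fintype.card_pos
      omega
    refine ⟨hne, fun d hd => ⟨fun T hT => ?_, fun A q hA hdiff => ?_⟩⟩
    · refine tvDist_map_le _ _ _ fun S => ?_
      refine (abs_realProb_yesDist_sub_le hd _ _ hne hfar T
        (nine_mul_sq_le_of_lt (Nat.cast_nonneg _) hT) S).trans (by norm_num)
    · by_contra hcon
      rw [not_le] at hcon
      have h1 := abs_acceptProb_yesDist_sub_le hd (le_trans (Nat.le_add_right d t) hd) _ hne hfar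
        A q hA (nine_mul_sq_le_of_lt (Nat.cast_nonneg _) hcon)
      have h2 := hdiff.trans h1
      norm_num at h2
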